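/- **Setting.** For $X\in\mathbb R^{n\times p}$ and $1\le k\le p$ let $\gamma_k(X)$ be the largest $\gamma$ such that $\frac1n\|X\beta\|_2^2\ge\gamma\|\beta\|_2^2$ for all $\beta$ with $\|\beta_{S^c}\|_1\le 3\|\beta_S\|_1$ for some $S\subseteq[p]$, $|S|=k$ (the restricted eigenvalue). A *black box* is a (measurable) map $(y,X,k)\mapsto \mathsf{SLR}(y,X,k)\in\mathbb R^p$, for $y\in\mathbb R^n$, $X\in\mathbb R^{n\times p}$ and all $n,p,k$, whose output is always $k$-sparse. Fix constants $K>2$ and $c,c',c''>0$. We say that $\mathsf{SLR}$ satisfies the *black-box condition* if for all $n$, $k$ and $p\ge2$, every fixed design $X\in\mathbb R^{n\times p}$ with $\gamma_k(X)>0$ and $\frac1n\|X\beta\|_2^2\le K\|\beta\|_2^2$ for all $2k$-sparse $\beta$, every $\sigma>0$ and every $k$-sparse $\beta^*$, with $w\sim N(0,\sigma^2 I_n)$ and $\widehat\beta=\mathsf{SLR}(X\beta^*+w,X,k)$, $$\frac1n\|X\widehat\beta-X\beta^*\|_2^2\le\frac{c}{\gamma_k(X)^2}\,\frac{\sigma^2k\log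 p}{n}\quad\text{with probability at least }1-c'\exp(-c''k\log p).$$ **Test.** Given a data matrix $\mathbf X\in\mathbb R^{n\times d}$ with columns $\mathbf X_i$, let $\mathbf X_{-i}$ be $\mathbf X$ without its $i$-th column, $\widehat\beta_i=\mathsf{SLR}(\mathbf X_i,\mathbf X_{-i},k)$ and $Q_i=\frac1n\|\mathbf X_i\|_2^2-\frac1n\|\mathbf X_i-\mathbf X_{-i}\widehat\beta_i\|_2^2$. The algorithm returns $\psi(\mathbf X)=1$ if $Q_i>\frac{13k\log(d/k)}{n}$ for some $i\in[d]$, and $\psi(\mathbf X)=0$ otherwise. **Theorem.** (a) For all $K>2$ and $c,c',c''>0$ there are constants $c_1,c_2,c_3,c_4>0$, depending only on $K,c,c',c''$, such that the following holds for every $\mathsf{SLR}$ satisfying the black-box condition. Let $k\ge1$, $d\ge ek$, $0<\theta\le1$, $c_{\min}>0$, and let $u\in\mathbb R^d$ be a $k$-sparse unit vector with $c_{\min}^2/k\le u_i^2\le1-c_{\min}^2/k$ for at least one $i\in[d]$. Suppose that $$\theta^2>\frac{c_1}{c_{\min}^2}\,\frac{k^2\log d}{n}\qquad\text{and}\qquad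 n>c_2k\log d .$$ Let the rows of $\mathbf X$ be $n$ i.i.d. samples from $N(0,I_d)$ under $H_0$ and from $N(0,I_d+\theta uu^\top)$ under $H_1$. Then $$\mathbf P_{H_0}(\psi(\mathbf X)=1)\le c_3\exp\bigl(-c_4k\log(d/k)\bigr),\qquad \mathbf P_{H_1}(\psi(\mathbf X)=0)\le c_3\exp(-c_4k\log d).$$ In particular, for every $\varepsilon\in(0,1]$ with $k\le d^{1-\varepsilon}$, $$\mathbf P_{H_0}(\psi(\mathbf X)=1)\vee\mathbf P_{H_1}(\psi(\mathbf X)=0)\le c_3\exp(-c_4\,\varepsilon\,k\log d).$$ (b) On a random access machine with unit-cost operations on natural numbers (addition and truncated subtraction), real numbers (arithmetic, logarithm and comparison) and entries of real matrices, where a call of $\mathsf{SLR}$ with $n$ samples, $p$ variables and sparsity $k$ costs $T(p,n,k)$, a direct implementation of the algorithm computes $\psi(\mathbf X)$ in time $O\bigl(d\,T(d-1,n,k)+d^2n\bigr)$, with an absolute implied constant, for all $d,n\ge1$, all $k$ and all $\mathbf X$. -/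

import Mathlib

open MeasureTheory ProbabilityTheory
open scoped NNReal

/-! ### Sparse linear regression -/

/-- A data or design matrix with `n` rows (samples) and `p` columns (variables). -/
abbrev Design (n p : ℕ) : Type := Fin n → Fin p → ℝ

/-- Squared Euclidean norm. -/
def sqNorm {m : ℕ} (v : Fin m → ℝ) : ℝ := ∑ a, v a ^ 2

/-- The matrix-vector product `X β`. -/
def applyDesign {n p : ℕ} (X : Design n p) (β : Fin p → ℝ) : Fin n → ℝ :=
  fun a => ∑ j, X a j * β j

/-- The cone `{β : ‖β_{Sᶜ}‖₁ ≤ 3 ‖β_S‖₁}`. -/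
def reCone {p : ℕ} (S : Finset (Fin p)) : Set (Fin p → ℝ) :=
  {β | ∑ j ∈ Sᶜ, |β j| ≤ 3 * ∑ j ∈ S, |β j|}

/-- The restricted eigenvalue of `X` at sparsity `k`: the largest `γ` such that
`‖X β‖² / n ≥ γ ‖β‖²` for all `β` in the union of the cones over supports of size `k`.
(For `1 ≤ k ≤ p` the supremum is a maximum and is nonnegative.) -/
noncomputable def restrictedEigenvalue {n p : ℕ} (X : Design n p) (k : ℕ) : ℝ :=
  sSup {γ : ℝ | ∀ S : Finset (Fin p), S.card = k → ∀ β ∈ reCone S,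
    γ * sqNorm β ≤ sqNorm (applyDesign X β) / n}

/-- Normalization of the design on sparse directions, with constant `K`:
`‖X β‖² / n ≤ K ‖β‖²` for all `2k`-sparse `β`. -/
def IsNormalized {n p : ℕ} (K : ℝ) (X : Design n p) (k : ℕ) : Prop :=
  ∀ β : Fin p → ℝ, hammingNorm β ≤ 2 * k → sqNorm (applyDesign X β) / n ≤ K * sqNorm β

/-- An SLR black box: `SLR n p y X k` is the estimated regression vector for the response `y`,
the design `X` (`n` samples, `p` variables) and the sparsity `k`. -/
abbrev Solver : Type :=
  ∀ n p : ℕ, (Fin n → ℝ) → Design n p → ℕ → (Fin p → ℝ)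

/-- The law of a noise vector with `n` i.i.d. `N(0, σ²)` entries. -/
noncomputable def noiseLaw (n : ℕ) (σ : ℝ≥0) : Measure (Fin n → ℝ) :=
  Measure.pi fun _ => gaussianReal 0 (σ ^ 2)

/-- The black-box condition: the output is always `k`-sparse and, for every fixed (normalized)
design with at least two variables and positive restricted eigenvalue and every `k`-sparse `β*`, the prediction error from
`y = X β* + w` is at most `(c / γ(X)²) σ² k log p / n` with probability at least
`1 - c' exp(-c'' k log p)` over the noise `w`. -/
structure BlackBoxCondition (SLR : Solver) (K c c' c'' : ℝ) : Prop where
  measurable : ∀ n p k : ℕ,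
    Measurable fun q : (Fin n → ℝ) × Design n p => SLR n p q.1 q.2 k
  sparse : ∀ (n p k : ℕ) (y : Fin n → ℝ) (X : Design n p), hammingNorm (SLR n p y X k) ≤ k
  prediction_error : ∀ (n p k : ℕ) (X : Design n p), 2 ≤ p → IsNormalized K X k →
    0 < restrictedEigenvalue X k →
    ∀ σ : ℝ≥0, 0 < σ → ∀ βstar : Fin p → ℝ, hammingNorm βstar ≤ k →
      1 - c' * Real.exp (-(c'' * k * Real.log p)) ≤
        (noiseLaw n σ).real
          {w | sqNorm (applyDesign X (SLR n p (applyDesign X βstar + w) X k)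
                  - applyDesign X βstar) / n
                ≤ c / restrictedEigenvalue X k ^ 2 * ((σ : ℝ) ^ 2 * k * Real.log p / n)}

/-! ### The spiked covariance model -/

/-- The law of `n` i.i.d. samples from `N(0, Γ)` in `ℝ^d`. -/
noncomputable def sampleLaw (n d : ℕ) (Γ : Matrix (Fin d) (Fin d) ℝ) :
    Measure (Fin n → EuclideanSpace ℝ (Fin d)) :=
  Measure.pi fun _ => multivariateGaussian 0 Γ

/-- The data matrix whose rows are the samples. -/
def dataMatrix {n d : ℕ} (x : Fin n → EuclideanSpace ℝ (Fin d)) : Design n d :=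
  fun a i => x a i

/-- The spiked covariance matrix `I + θ u uᵀ`. -/
def spikedCov {d : ℕ} (θ : ℝ) (u : Fin d → ℝ) : Matrix (Fin d) (Fin d) ℝ :=
  1 + θ • Matrix.vecMulVec u u

/-! ### The test -/

/-- The `j`-th index of `{0, …, d-1}` with `i` left out, in increasing order. -/
def skipIndex {d : ℕ} (i : Fin d) (j : Fin (d - 1)) : Fin d :=
  ⟨if (j : ℕ) < i then j else j + 1, by split <;> omega⟩

/-- The `i`-th column `X_i`. -/
def column {n d : ℕ} (X : Design n d) (i : Fin d) : Fin n → ℝ := fun a => X a i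

/-- The matrix `X_{-i}`: the `i`-th column removed. -/
def dropColumn {n d : ℕ} (X : Design n d) (i : Fin d) : Design n (d - 1) :=
  fun a j => X a (skipIndex i j)

/-- `Q_i = ‖X_i‖²/n - ‖X_i - X_{-i} β̂_i‖²/n` with `β̂_i = SLR(X_i, X_{-i}, k)`. -/
noncomputable def qStat (SLR : Solver) {n d : ℕ} (X : Design n d) (k : ℕ) (i : Fin d) : ℝ :=
  sqNorm (column X i) / n -
    sqNorm (column X i -
      applyDesign (dropColumn X i) (SLR n (d - 1) (column X i) (dropColumn X i) k)) / n

/-- The threshold `13 k log(d/k) / n`. -/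
noncomputable def qThreshold (n d k : ℕ) : ℝ := 13 * k * Real.log (d / k) / n

open Classical in
/-- The output of the test: `1` if some `Q_i` exceeds the threshold, and `0` otherwise. -/
noncomputable def qTest (SLR : Solver) {n d : ℕ} (X : Design n d) (k : ℕ) : ℕ :=
  if ∃ i : Fin d, qThreshold n d k < qStat SLR X k i then 1 else 0

/-- Type I error of the test: the probability of the output `1` under `N(0, I)`. -/
noncomputable def typeIError (SLR : Solver) (n d k : ℕ) : ℝ :=
  (sampleLaw n d 1).real {x | qTest SLR (dataMatrix x) k = 1}

/-- Type II error of the test: the probability of the output `0` under `N(0, I + θ u uᵀ)`. -/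
noncomputable def typeIIError (SLR : Solver) (n d k : ℕ) (θ : ℝ) (u : Fin d → ℝ) : ℝ :=
  (sampleLaw n d (spikedCov θ u)).real {x | qTest SLR (dataMatrix x) k = 0}

/-! ### A real random access machine with a regression oracle

Programs act on registers holding natural numbers (indices and sizes), registers holding reals,
and two-dimensional arrays of reals.  Every elementary instruction takes one step; a call of the
black box on an instance with `n` samples, `p` variables and sparsity `k` takes `T p n k` steps
(in addition to one step for the call, and to the steps that write the instance into memory). -/

/-- Programs. Registers and arrays are named by natural numbers. -/
inductive Prog : Type
  /-- `x := c` -/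
  | natConst (x c : ℕ)
  /-- `x := y + z` -/
  | natAdd (x y z : ℕ)
  /-- `x := y - z`, truncated at zero -/
  | natSub (x y z : ℕ)
  /-- `r := c` -/
  | realConst (r c : ℕ)
  /-- `r := x`, for a natural number register `x` -/
  | realOfNat (r x : ℕ)
  /-- `r := a + b` -/
  | realAdd (r a b : ℕ)
  /-- `r := a - b` -/
  | realSub (r a b : ℕ)
  /-- `r := a * b` -/
  | realMul (r a b : ℕ)
  /-- `r := a / b` -/
  | realDiv (r a b : ℕ)
  /-- `r := log a` -/
  | realLog (r a : ℕ)
  /-- `r := A[x][y]` -/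
  | load (r A x y : ℕ)
  /-- `A[x][y] := r` -/
  | store (A x y r : ℕ)
  /-- do nothing -/
  | skip
  /-- sequential composition -/
  | seq (P Q : Prog)
  /-- `if x < y then P else Q`, for natural number registers -/
  | natIfLt (x y : ℕ) (P Q : Prog)
  /-- `if a < b then P else Q`, for real registers -/
  | realIfLt (a b : ℕ) (P Q : Prog)
  /-- `for x = 0, …, N - 1 do P`, where `N` is the content of register `m` at the start -/
  | loop (x m : ℕ) (P : Prog)
  /-- `B := SLR(A, D, k)`: the response is column `0` of array `A` (`n` entries), the design is the
  upper left `n × p` block of array `D`, and the result is written to column `0` of array `B`;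
  the sizes `n`, `p`, `k` are read from registers `xn`, `xp`, `xk`. -/
  | call (A D B xn xp xk : ℕ)

/-- Memory contents. -/
structure MachineState where
  /-- natural number registers -/
  nat : ℕ → ℕ
  /-- real registers -/
  real : ℕ → ℝ
  /-- arrays: `mem A x y` is the entry in row `x` and column `y` of array `A` -/
  mem : ℕ → ℕ → ℕ → ℝ

namespace MachineState

/-- Write a natural number register. -/
def setNat (s : MachineState) (x v : ℕ) : MachineState :=
  { s with nat := fun y => if y = x then v else s.nat y }

/-- Write a real register. -/
def setReal (s : MachineState) (r : ℕ) (v : ℝ) : MachineState :=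
  { s with real := fun q => if q = r then v else s.real q }

/-- Write an array entry. -/
def setMem (s : MachineState) (A x y : ℕ) (v : ℝ) : MachineState :=
  { s with mem := fun A' x' y' => if A' = A ∧ x' = x ∧ y' = y then v else s.mem A' x' y' }

/-- Write a vector of length `p` to column `0` of an array. -/
def setVec (s : MachineState) (A : ℕ) {p : ℕ} (v : Fin p → ℝ) : MachineState :=
  { s with mem := fun A' x' y' =>
      if h : A' = A ∧ x' < p ∧ y' = 0 then v ⟨x', h.2.1⟩ else s.mem A' x' y' }

end MachineState

/-- Iterate a timed state transformer over `0, …, N - 1` with loop register `x`; each round costs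
one step more than the body. -/
def runLoop (f : MachineState → MachineState × ℕ) (x : ℕ) (s : MachineState) :
    ℕ → MachineState × ℕ
  | 0 => (s, 1)
  | i + 1 =>
    let before := runLoop f x s i
    let after := f (before.1.setNat x i)
    (after.1, before.2 + after.2 + 1)

open Classical in
/-- The final state and the number of steps of a program. -/
noncomputable def Prog.exec (SLR : Solver) (T : ℕ → ℕ → ℕ → ℕ) :
    Prog → MachineState → MachineState × ℕ
  | natConst x c, s => (s.setNat x c, 1)
  | natAdd x y z, s => (s.setNat x (s.nat y + s.nat z), 1)
  | natSub x y z, s => (s.setNat x (s.nat y - s.nat z), 1)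
  | realConst r c, s => (s.setReal r c, 1)
  | realOfNat r x, s => (s.setReal r (s.nat x), 1)
  | realAdd r a b, s => (s.setReal r (s.real a + s.real b), 1)
  | realSub r a b, s => (s.setReal r (s.real a - s.real b), 1)
  | realMul r a b, s => (s.setReal r (s.real a * s.real b), 1)
  | realDiv r a b, s => (s.setReal r (s.real a / s.real b), 1)
  | realLog r a, s => (s.setReal r (Real.log (s.real a)), 1)
  | load r A x y, s => (s.setReal r (s.mem A (s.nat x) (s.nat y)), 1)
  | store A x y r, s => (s.setMem A (s.nat x) (s.nat y) (s.real r), 1)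
  | skip, s => (s, 1)
  | seq P Q, s =>
    let first := P.exec SLR T s
    let second := Q.exec SLR T first.1
    (second.1, first.2 + second.2)
  | natIfLt x y P Q, s =>
    let branch := if s.nat x < s.nat y then P.exec SLR T s else Q.exec SLR T s
    (branch.1, branch.2 + 1)
  | realIfLt a b P Q, s =>
    let branch := if s.real a < s.real b then P.exec SLR T s else Q.exec SLR T s
    (branch.1, branch.2 + 1)
  | loop x m P, s => runLoop (P.exec SLR T) x s (s.nat m)
  | call A D B xn xp xk, s =>
    (s.setVec B (SLR (s.nat xn) (s.nat xp) (fun a => s.mem A a 0) (fun a j => s.mem D a j)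
        (s.nat xk)),
      T (s.nat xp) (s.nat xn) (s.nat xk) + 1)

/-- Sequential composition of a list of programs. -/
def Prog.block : List Prog → Prog
  | [] => Prog.skip
  | P :: Ps => Prog.seq P (Prog.block Ps)

/-- The initial state: the data matrix is in array `0`, and `n`, `d`, `k` are in the natural number
registers `0`, `1`, `2`; everything else is zero. -/
def inputState {n d : ℕ} (X : Design n d) (k : ℕ) : MachineState where
  nat := fun x => if x = 0 then n else if x = 1 then d else if x = 2 then k else 0
  real := fun _ => 0
  mem := fun A a i =>
    if h : A = 0 ∧ a < n ∧ i < d then X ⟨a, h.2.1⟩ ⟨i, h.2.2⟩ else 0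

namespace QProgram

/-! Natural number registers: `0, 1, 2` hold `n, d, k`; `3` the output; `4` the constant `0`;
`5` the constant `1`; `6` the number `p = d - 1`; `7` the loop index `i`; `8` the row index `a`;
`9` the column index `j`; `10` the index of the `j`-th column other than `i`.
Arrays: `0` the data, `1` the response, `2` the design, `3` the estimate.
Real registers: `0` the threshold, `1` the number `n`, `2` the sum `‖X_i‖²`, `3` the residual sum
of squares, `4` a residual, `5` and `6` temporary, `7` and `8` the numbers `d` and `k`. -/

/-- Constants and the threshold `13 k log(d/k) / n`. -/
def setup : Prog := Prog.block [
  .natConst 3 0, .natConst 4 0, .natConst 5 1, .natSub 6 1 5,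
  .realOfNat 1 0, .realOfNat 7 1, .realOfNat 8 2,
  .realDiv 5 7 8, .realLog 5 5,
  .realConst 0 13, .realMul 0 0 8, .realMul 0 0 5, .realDiv 0 0 1]

/-- Write the instance `(X_i, X_{-i})` to the arrays `1` and `2`. -/
def writeInstance : Prog :=
  .loop 8 0 (Prog.block [
    .load 5 0 8 7, .store 1 8 4 5,
    .loop 9 6 (Prog.block [
      .natIfLt 9 7 (.natAdd 10 9 4) (.natAdd 10 9 5),
      .load 5 0 8 10, .store 2 8 9 5])])

/-- Compute `‖X_i‖²` and `‖X_i - X_{-i} β̂_i‖²`. -/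
def sums : Prog := Prog.block [
  .realConst 2 0, .realConst 3 0,
  .loop 8 0 (Prog.block [
    .load 4 1 8 4,
    .realMul 5 4 4, .realAdd 2 2 5,
    .loop 9 6 (Prog.block [
      .load 5 2 8 9, .load 6 3 9 4, .realMul 5 5 6, .realSub 4 4 5]),
    .realMul 5 4 4, .realAdd 3 3 5])]

/-- The test: for every `i` call the black box, compute `Q_i`, and set the output to `1` if it
exceeds the threshold. -/
def main : Prog := .seq setup (.loop 7 1 (Prog.block [
  writeInstance,
  .call 1 2 3 0 6 2,
  sums,
  .realDiv 2 2 1, .realDiv 3 3 1, .realSub 5 2 3,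
  .realIfLt 0 5 (.natConst 3 1) .skip]))

end QProgram

/-! ### Gaussian quadratic forms -/

/-! For a response `y` and a prediction `v`, the gain `‖y‖² - ‖y - v‖²` equals `2⟨y, v⟩ - ‖v‖²`.
Under the null hypothesis `y` is white noise independent of the other columns. If `v` lies in the
span of at most `k` columns, the gain is at most the squared length of the projection of `y` onto
that span, a chi-squared variable with at most `k` degrees of freedom. A union bound over supports
and over columns gives the type I error; of the black box it uses only sparsity and measurability.

Under the alternative, one well-chosen column `i` suffices. Gaussian regression writes it as `X_{-i}
β + w`, where `w` is independent of `X_{-i}` with variance between 1 and 2, and `β` is a multiple of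
`u` without coordinate `i`, with `‖β‖²` at least of order `θ² cmin² / k`. Conditionally on the
design this is the fixed-design problem of the black box, provided that the design is normalized and
has a restricted eigenvalue bounded below. The estimate then predicts almost as well as `β`, and the
gain is at least `‖X_{-i} β‖² / 2` minus terms of order `k log d` (`le_sqNorm_sub_sqNorm`,
`fitGain_le_threshold_tail`).

The design is controlled through Maurey's empirical method (`exists_atom_le`, `nonneg_of_atoms`). A
quadratic form that is nonnegative on sums of `m` signed basis vectors is nonnegative everywhere up
to `D ‖x‖₁² / (m - 1)`, where `D` bounds its diagonal. There are finitely many such sums, so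
chi-squared tails and a union bound suffice. With `m - 1` a large multiple of `k` the correction is
harmless on the cones and on sparse vectors.

The running time is a separate matter: a loop-invariant calculus with step counts is applied to the
explicit program. -/

lemma integrable_exp_mul_sq_gaussianReal {t : ℝ} (ht : t < 1 / 2) :
    Integrable (fun x => Real.exp (t * x ^ 2)) (gaussianReal 0 1) ∧
      ∫ x, Real.exp (t * x ^ 2) ∂gaussianReal 0 1 = (√(1 - 2 * t))⁻¹ := by
  have hb : 0 < 1 / 2 - t := by linarith
  have hpdf : ∀ x : ℝ, gaussianPDFReal 0 1 x * Real.exp (t * x ^ 2) =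
      (√(2 * Real.pi))⁻¹ * Real.exp (-(1 / 2 - t) * x ^ 2) := by
    intro x
    simp only [gaussianPDFReal, NNReal.coe_one, mul_one, sub_zero]
    rw [mul_assoc, ← Real.exp_add]
    congr 2
    ring
  constructor
  · rw [gaussianReal_of_var_ne_zero _ one_ne_zero, gaussianPDF_def,
      integrable_withDensity_iff_integrable_smul' (by fun_prop) (by simp)]
    simp_rw [ENNReal.toReal_ofReal (gaussianPDFReal_nonneg _ _ _), smul_eq_mul, hpdf]
    exact (integrable_exp_neg_mul_sq hb).const_mul _
  · rw [integral_gaussianReal_eq_integral_smul one_ne_zero]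
    simp_rw [smul_eq_mul, hpdf]
    rw [integral_const_mul, integral_gaussian, ← Real.sqrt_inv, ← Real.sqrt_inv,
      ← Real.sqrt_mul (by positivity)]
    congr 1
    have : 1 - 2 * t ≠ 0 := by linarith
    field_simp

section Tails

variable {ι : Type*} [Fintype ι]

lemma mgf_sum_sq_gaussian (J : Finset ι) {t : ℝ} (ht : t < 1 / 2) :
    Integrable (fun x : ι → ℝ => Real.exp (t * ∑ a ∈ J, x a ^ 2))
        (Measure.pi fun _ => gaussianReal 0 1) ∧
      mgf (fun x : ι → ℝ => ∑ a ∈ J, x a ^ 2) (Measure.pi fun _ => gaussianReal 0 1) t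
        = (√(1 - 2 * t))⁻¹ ^ J.card := by
  classical
  have hf : ∀ x : ι → ℝ, Real.exp (t * ∑ a ∈ J, x a ^ 2) =
      ∏ a, (if a ∈ J then fun y : ℝ => Real.exp (t * y ^ 2) else fun _ => 1) (x a) := by
    intro x
    rw [Finset.mul_sum, Real.exp_sum, ← Finset.prod_subset (Finset.subset_univ J)]
    · exact Finset.prod_congr rfl fun a ha => by simp [ha]
    · intro a _ ha
      simp [ha]
  obtain ⟨h1, h2⟩ := integrable_exp_mul_sq_gaussianReal ht
  constructor
  · simp_rw [hf]
    refine Integrable.fintype_prod fun a => ?_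
    split_ifs
    · exact h1
    · exact integrable_const _
  · simp_rw [mgf, hf]
    rw [integral_fintype_prod_eq_prod, ← Finset.prod_subset (Finset.subset_univ J)]
    · rw [Finset.prod_congr rfl (g := fun _ => (√(1 - 2 * t))⁻¹) fun a ha => by simpa [ha] using h2,
        Finset.prod_const]
    · intro a _ ha
      simp [ha]

lemma sum_sq_gaussian_ge_le (J : Finset ι) {t : ℝ} (h0 : 0 ≤ t) (ht : t < 1 / 2) (T : ℝ) :
    (Measure.pi fun _ : ι => gaussianReal 0 1).real {x | T ≤ ∑ a ∈ J, x a ^ 2} ≤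
      Real.exp (-t * T) * (√(1 - 2 * t))⁻¹ ^ J.card := by
  obtain ⟨h1, h2⟩ := mgf_sum_sq_gaussian J ht
  rw [← h2]
  exact measure_ge_le_exp_mul_mgf T h0 h1

/-- The exponential rate of the deviations of a chi-squared average from its mean. -/
noncomputable def chiRate (κ : ℝ) : ℝ := (κ - 1 - Real.log κ) / 2

lemma chiRate_pos {κ : ℝ} (h0 : 0 < κ) (h1 : κ ≠ 1) : 0 < chiRate κ := by
  have := Real.log_lt_sub_one_of_pos h0 h1
  unfold chiRate
  linarith

/-- The parameter `t = (1 - κ⁻¹) / 2` optimizes the Chernoff bound, since then `1 - 2t = κ⁻¹`. It is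
positive for `κ > 1` and negative for `κ < 1`, so the same identity serves both tails. -/
lemma exp_mul_pow_eq_chiRate {κ : ℝ} (h0 : 0 < κ) (n : ℕ) :
    Real.exp (-((1 - κ⁻¹) / 2) * (κ * n)) * (√(1 - 2 * ((1 - κ⁻¹) / 2)))⁻¹ ^ n =
      Real.exp (-(chiRate κ * n)) := by
  have h : (√(1 - 2 * ((1 - κ⁻¹) / 2)))⁻¹ = Real.exp (Real.log κ / 2) := by
    rw [show 1 - 2 * ((1 - κ⁻¹) / 2) = κ⁻¹ by ring, Real.sqrt_inv, inv_inv,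
      Real.exp_half, Real.exp_log h0]
  rw [h, ← Real.exp_nat_mul, ← Real.exp_add, chiRate]
  congr 1
  field_simp
  ring

lemma sum_sq_gaussian_ge_le_chiRate {κ : ℝ} (h1 : 1 < κ) :
    (Measure.pi fun _ : ι => gaussianReal 0 1).real {x | κ * Fintype.card ι ≤ ∑ a, x a ^ 2} ≤
      Real.exp (-(chiRate κ * Fintype.card ι)) := by
  have h0 : 0 < κ := by linarith
  have h2 : 0 < κ⁻¹ := by positivity
  have h3 : κ⁻¹ < 1 := inv_lt_one_of_one_lt₀ h1
  rw [← exp_mul_pow_eq_chiRate h0]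
  exact sum_sq_gaussian_ge_le Finset.univ (by linarith) (by linarith) _

lemma sum_sq_gaussian_le_le_chiRate {κ : ℝ} (h0 : 0 < κ) (h1 : κ < 1) :
    (Measure.pi fun _ : ι => gaussianReal 0 1).real {x | ∑ a, x a ^ 2 ≤ κ * Fintype.card ι} ≤
      Real.exp (-(chiRate κ * Fintype.card ι)) := by
  have h3 : 1 < κ⁻¹ := (one_lt_inv₀ h0).2 h1
  have ht : (1 - κ⁻¹) / 2 < 1 / 2 := by linarith
  obtain ⟨h4, h5⟩ := mgf_sum_sq_gaussian (Finset.univ : Finset ι) ht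
  rw [← exp_mul_pow_eq_chiRate h0, ← Finset.card_univ, ← h5]
  exact measure_le_le_exp_mul_mgf _ (by linarith) h4

end Tails

/-! ### Projections of Gaussian noise -/

/-- Completing the square bounds `2⟨w, v⟩ - ‖v‖²` on `V` by the squared length of the projection of
`w`. An orthonormal basis adapted to `V` turns this length into a sum of squared coordinates, which
are i.i.d. for Gaussian `w`. -/
lemma exists_orthonormalBasis_sum_sq {n : ℕ} (V : Submodule ℝ (EuclideanSpace ℝ (Fin n))) :
    ∃ (b : OrthonormalBasis (Fin n) ℝ (EuclideanSpace ℝ (Fin n))) (J : Finset (Fin n)),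
      J.card = Module.finrank ℝ V ∧
        ∀ w, ∀ v ∈ V, 2 * inner ℝ w v - ‖v‖ ^ 2 ≤ ∑ a ∈ J, inner ℝ (b a) w ^ 2 := by
  classical
  set r := Module.finrank ℝ V with hr
  have hrn : r ≤ n := by
    simpa using Submodule.finrank_le V
  let e := stdOrthonormalBasis ℝ V
  -- The zero values off `J` are placeholders: the extension theorem only looks at `v` on `J`.
  let v : Fin n → EuclideanSpace ℝ (Fin n) :=
    fun a => if h : (a : ℕ) < r then (e ⟨a, h⟩ : EuclideanSpace ℝ (Fin n)) else 0
  let J : Finset (Fin n) := Finset.univ.filter fun a => (a : ℕ) < r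
  have hv : Orthonormal ℝ ((J : Set (Fin n)).domRestrict v) := by
    have he : Orthonormal ℝ fun a => (e a : EuclideanSpace ℝ (Fin n)) :=
      e.orthonormal.comp_linearIsometry V.subtypeₗᵢ
    let g : {a // a ∈ (J : Set (Fin n))} → Fin r := fun a => ⟨a.1, by simpa [J] using a.2⟩
    have hg : Function.Injective g := fun a a' h => by
      apply Subtype.ext
      apply Fin.ext
      simpa [g] using h
    have hvg : (J : Set (Fin n)).domRestrict v =
        (fun l => (e l : EuclideanSpace ℝ (Fin n))) ∘ g := by
      funext a
      have : (a.1 : ℕ) < r := by simpa [J] using a.2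
      simp [v, g, this]
    rw [hvg]
    exact he.comp g hg
  obtain ⟨b, hb⟩ := hv.exists_orthonormalBasis_extension_of_card_eq (by simp)
  refine ⟨b, J, ?_, ?_⟩
  · have : J = Finset.univ.map (Fin.castLEEmb hrn) := by
      ext a
      simp only [J, Finset.mem_filter, Finset.mem_univ, true_and, Finset.mem_map,
        Fin.castLEEmb_apply]
      constructor
      · intro h
        exact ⟨⟨a, h⟩, rfl⟩
      · rintro ⟨c, rfl⟩
        exact c.2
    rw [this]
    simp
  · intro w x hx
    have hout : ∀ a ∉ J, inner ℝ (b a) x = 0 := by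
      intro a ha
      have hxe : x = ∑ l, (e.repr ⟨x, hx⟩ l) • (e l : EuclideanSpace ℝ (Fin n)) := by
        have := congrArg (Subtype.val) (e.sum_repr ⟨x, hx⟩)
        simpa using this.symm
      rw [hxe, inner_sum]
      refine Finset.sum_eq_zero fun l _ => ?_
      have hl : (⟨l, l.2.trans_le hrn⟩ : Fin n) ∈ J := by simp [J, hr]
      have : (e l : EuclideanSpace ℝ (Fin n)) = b ⟨l, l.2.trans_le hrn⟩ := by
        rw [hb _ hl]
        simp [v, hr]
      rw [this, inner_smul_right, b.orthonormal.inner_eq_zero (by rintro rfl; exact ha hl), mul_zero]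
    have h1 : inner ℝ w x = ∑ a ∈ J, inner ℝ (b a) w * inner ℝ (b a) x := by
      rw [← b.sum_inner_mul_inner w x, ← Finset.sum_subset (Finset.subset_univ J)]
      · exact Finset.sum_congr rfl fun a _ => by rw [real_inner_comm]
      · intro a _ ha
        rw [hout a ha, mul_zero]
    have h2 : ‖x‖ ^ 2 = ∑ a ∈ J, inner ℝ (b a) x ^ 2 := by
      rw [← b.sum_sq_inner_right x, ← Finset.sum_subset (Finset.subset_univ J)]
      intro a _ ha
      rw [hout a ha]
      simp
    rw [h1, h2, Finset.mul_sum, ← Finset.sum_sub_distrib]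
    refine Finset.sum_le_sum fun a _ => ?_
    nlinarith [sq_nonneg (inner ℝ (b a) w - inner ℝ (b a) x)]

/-- Chernoff with `t = 3/8`, for which `(1 - 2t)^(-1/2)` is exactly 2, so each dimension costs a
factor 2. -/
lemma gaussian_projection_tail {n : ℕ} (V : Submodule ℝ (EuclideanSpace ℝ (Fin n))) {s : ℕ}
    (hs : Module.finrank ℝ V ≤ s) (T : ℝ) :
    (stdGaussian (EuclideanSpace ℝ (Fin n))).real
        {w | ∃ v ∈ V, T < 2 * inner ℝ w v - ‖v‖ ^ 2} ≤ 2 ^ s * Real.exp (-(3 / 8 * T)) := by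
  obtain ⟨b, J, hJ, h⟩ := exists_orthonormalBasis_sum_sq V
  calc _ ≤ (stdGaussian (EuclideanSpace ℝ (Fin n))).real
        {w | T ≤ ∑ a ∈ J, inner ℝ (b a) w ^ 2} := by
        refine measureReal_mono ?_ (measure_ne_top _ _)
        rintro w ⟨v, hv, hT⟩
        exact hT.le.trans (h w v hv)
    _ = (Measure.pi fun _ : Fin n => gaussianReal 0 1).real {x | T ≤ ∑ a ∈ J, x a ^ 2} := by
        rw [stdGaussian_eq_map_pi_orthonormalBasis b, map_measureReal_apply (by fun_prop)]
        · congr 1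
          ext x
          simp only [Set.preimage_ofPred_eq, Set.mem_ofPred_eq]
          have : ∀ a, inner ℝ (b a) (∑ i, x i • b i) = x a := fun a => by
            simp [inner_sum, inner_smul_right, b.inner_eq_ite]
          simp_rw [this]
        · exact measurableSet_le measurable_const (by fun_prop)
    _ ≤ Real.exp (-(3 / 8) * T) * (√(1 - 2 * (3 / 8)))⁻¹ ^ J.card :=
        sum_sq_gaussian_ge_le J (by norm_num) (by norm_num) T
    _ ≤ _ := by
        have : (√(1 - 2 * (3 / 8)))⁻¹ = (2 : ℝ) := by
          rw [show (1 - 2 * (3 / 8) : ℝ) = (1 / 2) ^ 2 by norm_num, Real.sqrt_sq (by norm_num)]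
          norm_num
        rw [this, mul_comm, neg_mul]
        gcongr
        · norm_num
        · omega

lemma map_mul_gaussianReal (σ : ℝ≥0) :
    (gaussianReal 0 1).map (fun x => (σ : ℝ) * x) = gaussianReal 0 (σ ^ 2) := by
  rw [gaussianReal_map_const_mul]
  congr 1
  · simp
  · ext
    simp

lemma map_smul_pi_gaussianReal {n : ℕ} (σ : ℝ≥0) :
    (Measure.pi fun _ : Fin n => gaussianReal 0 1).map (fun x => (σ : ℝ) • x) = noiseLaw n σ := by
  rw [noiseLaw, ← map_mul_gaussianReal, ← Measure.pi_map_pi fun _ => by fun_prop]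
  rfl

lemma applyDesign_smul {n p : ℕ} (X : Design n p) (r : ℝ) (β : Fin p → ℝ) :
    applyDesign X (r • β) = r • applyDesign X β := by
  ext a
  simp [applyDesign, Finset.mul_sum, mul_left_comm]

lemma applyDesign_sub {n p : ℕ} (X : Design n p) (β γ : Fin p → ℝ) :
    applyDesign X (β - γ) = applyDesign X β - applyDesign X γ := by
  ext a
  simp [applyDesign, mul_sub, Finset.sum_sub_distrib]

lemma sqNorm_smul {m : ℕ} (r : ℝ) (v : Fin m → ℝ) : sqNorm (r • v) = r ^ 2 * sqNorm v := by
  simp [sqNorm, mul_pow, Finset.mul_sum]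

lemma sqNorm_nonneg {m : ℕ} (v : Fin m → ℝ) : 0 ≤ sqNorm v :=
  Finset.sum_nonneg fun _ _ => sq_nonneg _

lemma toLp_applyDesign_eq_sum {n p : ℕ} (X : Design n p) {β : Fin p → ℝ} {S : Finset (Fin p)}
    (hS : ∀ j, β j ≠ 0 → j ∈ S) :
    WithLp.toLp 2 (applyDesign X β) =
      ∑ j ∈ S, β j • (WithLp.toLp 2 fun a => X a j : EuclideanSpace ℝ (Fin n)) := by
  ext a
  simp only [applyDesign, WithLp.ofLp_sum, WithLp.ofLp_smul, Finset.sum_apply, Pi.smul_apply,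
    smul_eq_mul]
  rw [← Finset.sum_subset (Finset.subset_univ S)]
  · exact Finset.sum_congr rfl fun j _ => mul_comm _ _
  · intro j _ hj
    rw [not_not.1 (mt (hS j) hj), mul_zero]

lemma real_inner_toLp_right {n : ℕ} (w : EuclideanSpace ℝ (Fin n)) (v : Fin n → ℝ) :
    inner ℝ w (WithLp.toLp 2 v) = ∑ a, w a * v a := by
  simp [PiLp.inner_apply, mul_comm]

/-- Twice the correlation of a sparse prediction with the noise, minus its squared norm, exceeds
`σ² T` with exponentially small probability, uniformly over sparse predictions. -/
lemma noiseLaw_sparse_tail {n p s : ℕ} (X : Design n p) (hs : s ≤ p) {σ : ℝ≥0} (hσ : 0 < σ)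
    (T : ℝ) :
    (noiseLaw n σ).real {w | ∃ β : Fin p → ℝ, hammingNorm β ≤ s ∧
        (σ : ℝ) ^ 2 * T < 2 * ∑ a, w a * applyDesign X β a - sqNorm (applyDesign X β)} ≤
      p.choose s * (2 ^ s * Real.exp (-(3 / 8 * T))) := by
  classical
  have hσ' : (0 : ℝ) < σ := by exact_mod_cast hσ
  let col : Fin p → EuclideanSpace ℝ (Fin n) := fun j => WithLp.toLp 2 fun a => X a j
  let V : Finset (Fin p) → Submodule ℝ (EuclideanSpace ℝ (Fin n)) := fun S => Submodule.span ℝ (S.image col : Set (EuclideanSpace ℝ (Fin n)))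
  -- Scaling by `σ` as a measurable equivalence: the image measure can then be evaluated on the
  -- event without proving it measurable.
  let e : EuclideanSpace ℝ (Fin n) ≃ᵐ (Fin n → ℝ) :=
    (MeasurableEquiv.toLp 2 (Fin n → ℝ)).symm.trans (MeasurableEquiv.smul₀ (σ : ℝ) hσ'.ne')
  have hlaw : noiseLaw n σ = (stdGaussian (EuclideanSpace ℝ (Fin n))).map e := by
    rw [← map_smul_pi_gaussianReal, ← map_pi_eq_stdGaussian, Measure.map_map e.measurable
      (by fun_prop)]
    rfl
  rw [hlaw, measureReal_def, e.map_apply, ← measureReal_def]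
  calc _ ≤ (stdGaussian (EuclideanSpace ℝ (Fin n))).real (⋃ S ∈ Finset.powersetCard s (Finset.univ : Finset (Fin p)),
          {w | ∃ v ∈ V S, T < 2 * inner ℝ w v - ‖v‖ ^ 2}) := by
        refine measureReal_mono ?_ (measure_ne_top _ _)
        rintro w ⟨β, hβ, hT⟩
        -- The support is enlarged to exactly `s` elements, so that the union runs over `p.choose s`
        -- subspaces. Dividing the prediction by `σ` below divides the whole expression by `σ²`.
        obtain ⟨S, hS, hcard⟩ := Finset.exists_superset_card_eq
          (s := Finset.univ.filter fun j => β j ≠ 0) (n := s) hβ (by simpa using hs)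
        simp only [Set.mem_iUnion, Finset.mem_powersetCard, Finset.subset_univ, true_and]
        refine ⟨S, hcard, (σ : ℝ)⁻¹ • WithLp.toLp 2 (applyDesign X β), ?_, ?_⟩
        · refine Submodule.smul_mem _ _ ?_
          rw [toLp_applyDesign_eq_sum X fun j h0 => hS (by simp [h0])]
          refine Submodule.sum_mem _ fun j hj => Submodule.smul_mem _ _ (Submodule.subset_span ?_)
          simpa using ⟨j, hj, rfl⟩
        · have hw : ∀ a, e w a = σ * w a := fun a => rfl
          have h1 : ∑ a, e w a * applyDesign X β a =
              σ * inner ℝ w (WithLp.toLp 2 (applyDesign X β) : EuclideanSpace ℝ (Fin n)) := by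
            simp only [real_inner_toLp_right, hw, Finset.mul_sum, mul_assoc]
          have h2 : sqNorm (applyDesign X β) = ‖(WithLp.toLp 2 (applyDesign X β) : EuclideanSpace ℝ (Fin n))‖ ^ 2 := by
            rw [EuclideanSpace.real_norm_sq_eq]
            rfl
          rw [h1, h2] at hT
          rw [inner_smul_right, norm_smul, norm_inv, Real.norm_of_nonneg hσ'.le, mul_pow, inv_pow]
          refine lt_of_mul_lt_mul_left (hT.trans_eq ?_) (sq_nonneg (σ : ℝ))
          field_simp
    _ ≤ ∑ S ∈ Finset.powersetCard s (Finset.univ : Finset (Fin p)),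
          2 ^ s * Real.exp (-(3 / 8 * T)) := by
        refine (measureReal_biUnion_finset_le _ _).trans (Finset.sum_le_sum fun S hS => ?_)
        refine gaussian_projection_tail (V S) ?_ T
        refine (finrank_span_finset_le_card _).trans (Finset.card_image_le.trans ?_)
        exact (Finset.mem_powersetCard.1 hS).2.le
    _ = _ := by simp

/-! ### From sparse atoms to all vectors -/

/-- The sum of `m` signed basis vectors. -/
def atom {p m : ℕ} (f : Fin m → Fin p × Bool) : Fin p → ℝ :=
  ∑ a, Pi.single (f a).1 (if (f a).2 then 1 else -1)

/-- Maurey's empirical method, derandomized. Draw `m` independent indices `j` with probabilities `|x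
j|` and attach the sign of `x j`; each draw has mean `x`, and the right side bounds the expected
value of the form at `v` plus the draws. Draws are fixed one at a time without exceeding this mean,
which is why the induction needs an arbitrary starting vector `v`. -/
lemma exists_atom_le {p : ℕ} (B : LinearMap.BilinForm ℝ (Fin p → ℝ)) (hB : B.IsSymm) {D : ℝ}
    (hD : ∀ j, B (Pi.single j 1) (Pi.single j 1) ≤ D) {x : Fin p → ℝ} (hx : ∑ j, |x j| = 1)
    (m : ℕ) : ∀ v : Fin p → ℝ, ∃ f : Fin m → Fin p × Bool,
      B (v + atom f) (v + atom f) ≤ B v v + 2 * m * B v x + m * D + m * (m - 1) * B x x := by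
  induction m with
  | zero =>
    intro v
    exact ⟨Fin.elim0, by simp [atom]⟩
  | succ m ih =>
    intro v
    let z : Fin p → Fin p → ℝ := fun j => Pi.single j (if 0 ≤ x j then 1 else -1)
    have hxz : ∑ j, |x j| • z j = x := by
      have h1 : ∀ j, |x j| • z j = Pi.single j (x j) := by
        intro j
        rw [← Pi.single_smul, smul_eq_mul]
        congr 1
        split_ifs with h
        · rw [abs_of_nonneg h, mul_one]
        · rw [abs_of_neg (not_le.1 h)]
          ring
      simp_rw [h1]
      exact Finset.univ_sum_single x
    have hz : ∀ j, B (z j) (z j) ≤ D := by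
      intro j
      have h1 : z j = (if 0 ≤ x j then (1 : ℝ) else -1) • Pi.single j 1 := by
        simp only [z, ← Pi.single_smul, smul_eq_mul, mul_one]
      rw [h1]
      split_ifs <;> simpa using hD j
    have hBx : ∀ y, ∑ j, |x j| * B y (z j) = B y x := by
      intro y
      conv_rhs => rw [← hxz]
      simp [map_sum]
    have hBx' : ∀ y, ∑ j, |x j| * B (z j) y = B x y := by
      intro y
      simp_rw [fun j => hB.eq (z j) y, hB.eq x y]
      exact hBx y
    -- The part of the bound for the remaining `m` draws that depends on the first draw `z j`. Its
    -- average with weights `|x j|` is at most the claimed value, so some `j` attains that.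
    let φ : Fin p → ℝ := fun j =>
      B (v + z j) (v + z j) + 2 * m * B (v + z j) x
    have hφ : ∃ j, φ j ≤ B v v + 2 * B v x + D + 2 * m * (B v x + B x x) := by
      by_contra! hcon
      have h1 : ∑ j, |x j| * φ j ≤ B v v + 2 * B v x + D + 2 * m * (B v x + B x x) := by
        have h2 : ∑ j, |x j| * φ j = B v v * ∑ j, |x j| + 2 * ∑ j, |x j| * B v (z j)
            + ∑ j, |x j| * B (z j) (z j) + 2 * m * (B v x * ∑ j, |x j| + ∑ j, |x j| * B (z j) x) := by
          simp only [Finset.mul_sum, ← Finset.sum_add_distrib, φ, map_add, LinearMap.add_apply]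
          refine Finset.sum_congr rfl fun j _ => ?_
          rw [← hB.eq v (z j)]
          ring
        have h3 : ∑ j, |x j| * B (z j) (z j) ≤ D := by
          calc _ ≤ ∑ j, |x j| * D := Finset.sum_le_sum fun j _ =>
                mul_le_mul_of_nonneg_left (hz j) (abs_nonneg _)
            _ = D := by rw [← Finset.sum_mul, hx, one_mul]
        rw [h2, hx, hBx, hBx']
        linarith
      have h4 : (B v v + 2 * B v x + D + 2 * m * (B v x + B x x)) < ∑ j, |x j| * φ j := by
        set R := B v v + 2 * B v x + D + 2 * m * (B v x + B x x)
        calc R = ∑ j, |x j| * R := by rw [← Finset.sum_mul, hx, one_mul]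
          _ < _ := by
            refine Finset.sum_lt_sum (fun j _ =>
              mul_le_mul_of_nonneg_left (hcon j).le (abs_nonneg _)) ?_
            have : ∃ j, 0 < |x j| := by
              by_contra! h0
              have : ∑ j, |x j| ≤ 0 := Finset.sum_nonpos fun j _ => h0 j
              linarith
            obtain ⟨j, hj⟩ := this
            exact ⟨j, Finset.mem_univ _, mul_lt_mul_of_pos_left (hcon j) hj⟩
      linarith
    obtain ⟨j, hj⟩ := hφ
    obtain ⟨f, hf⟩ := ih (v + z j)
    refine ⟨Fin.cons (j, decide (0 ≤ x j)) f, ?_⟩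
    have h5 : v + atom (Fin.cons (j, decide (0 ≤ x j)) f : Fin (m + 1) → Fin p × Bool)
        = v + z j + atom f := by
      rw [atom, Fin.sum_univ_succ, add_assoc]
      simp [atom, z]
    rw [h5]
    refine hf.trans ?_
    simp only [φ] at hj
    push_cast
    nlinarith [hj]

/-- A quadratic form that is nonnegative on sums of `m` signed basis vectors is nonnegative on all
vectors, up to a multiple of the squared `ℓ¹` norm. -/
lemma nonneg_of_atoms {p m : ℕ} (hm : 0 < m) (B : LinearMap.BilinForm ℝ (Fin p → ℝ))
    (hB : B.IsSymm) {D : ℝ} (hD : ∀ j, B (Pi.single j 1) (Pi.single j 1) ≤ D)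
    (hf : ∀ f : Fin m → Fin p × Bool, 0 ≤ B (atom f) (atom f)) (x : Fin p → ℝ) :
    0 ≤ (m - 1) * B x x + D * (∑ j, |x j|) ^ 2 := by
  set N := ∑ j, |x j| with hN
  rcases eq_or_ne N 0 with h0 | h0
  · have hx : x = 0 := by
      ext j
      have := (Finset.sum_eq_zero_iff_of_nonneg fun j _ => abs_nonneg (x j)).1 h0 j
        (Finset.mem_univ _)
      simpa using this
    simp [hx, h0]
  · have hN0 : 0 < N := lt_of_le_of_ne (Finset.sum_nonneg fun _ _ => abs_nonneg _) h0.symm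
    have h1 : ∑ j, |(N⁻¹ • x) j| = 1 := by
      simp only [Pi.smul_apply, smul_eq_mul, abs_mul, abs_of_pos (inv_pos.2 hN0)]
      rw [← Finset.mul_sum, ← hN, inv_mul_cancel₀ h0]
    -- Starting from 0 removes the linear term: some atom has value at most `m (D + (m - 1) B x x /
    -- N²)`, and this value is nonnegative by assumption.
    obtain ⟨f, h2⟩ := exists_atom_le B hB hD h1 m 0
    have h3 := hf f
    have h4 : B (N⁻¹ • x) (N⁻¹ • x) = N⁻¹ ^ 2 * B x x := by
      simp
      ring
    rw [zero_add, h4] at h2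
    simp only [map_zero, LinearMap.zero_apply, mul_zero, add_zero, zero_add] at h2
    have hm' : (0 : ℝ) < m := by exact_mod_cast hm
    have h5 : 0 ≤ m * (D + (m - 1) * (N⁻¹ ^ 2 * B x x)) := by linarith
    have h6 := nonneg_of_mul_nonneg_right h5 hm'
    have h7 : (m - 1) * B x x + D * N ^ 2 = N ^ 2 * (D + (m - 1) * (N⁻¹ ^ 2 * B x x)) := by
      field_simp
      ring
    rw [h7]
    positivity

/-! ### Regression of one coordinate of the spiked model on the others -/

lemma sum_eq_add_sum_skipIndex {d : ℕ} (i : Fin d) (f : Fin d → ℝ) :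
    ∑ j, f j = f i + ∑ j, f (skipIndex i j) := by
  obtain _ | d := d
  · exact i.elim0
  rw [Fin.sum_univ_succAbove f i]
  congr 1
  refine Finset.sum_congr rfl fun j _ => congrArg f ?_
  ext
  simp only [skipIndex, Fin.succAbove, Fin.lt_def, Fin.val_castSucc]
  split_ifs <;> simp

lemma skipIndex_ne {d : ℕ} (i : Fin d) (j : Fin (d - 1)) : skipIndex i j ≠ i := by
  intro h
  have := congrArg Fin.val h
  simp only [skipIndex] at this
  split_ifs at this <;> omega

lemma posSemidef_spikedCov {d : ℕ} {θ : ℝ} (hθ : 0 ≤ θ) (u : Fin d → ℝ) :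
    (spikedCov θ u).PosSemidef := by
  have h := Matrix.posSemidef_vecMulVec_self_star u
  rw [star_trivial] at h
  exact Matrix.PosSemidef.one.add (h.smul hθ)

lemma spikedCov_apply {d : ℕ} (θ : ℝ) (u : Fin d → ℝ) (i j : Fin d) :
    spikedCov θ u i j = (if i = j then 1 else 0) + θ * (u i * u j) := by
  simp [spikedCov, Matrix.one_apply, Matrix.vecMulVec_apply]

lemma dotProduct_spikedCov_mulVec {d : ℕ} (θ : ℝ) (u a : Fin d → ℝ) :
    a ⬝ᵥ (spikedCov θ u).mulVec a = ∑ j, a j ^ 2 + θ * (∑ j, u j * a j) ^ 2 := by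
  have h1 : (spikedCov θ u).mulVec a = a + (θ * ∑ j, u j * a j) • u := by
    ext l
    simp only [Matrix.mulVec, dotProduct, spikedCov_apply, add_mul, Finset.sum_add_distrib, ite_mul,
      one_mul, zero_mul, Finset.sum_ite_eq, Finset.mem_univ, if_true, Pi.add_apply, Pi.smul_apply,
      smul_eq_mul, Finset.mul_sum, Finset.sum_mul]
    congr 1
    exact Finset.sum_congr rfl fun j _ => by ring
  rw [h1, dotProduct_add, dotProduct_smul, smul_eq_mul, dotProduct_comm a u]
  simp only [dotProduct, ← sq]
  ring

lemma map_sum_mul_multivariateGaussian {d : ℕ} {S : Matrix (Fin d) (Fin d) ℝ} (hS : S.PosSemidef)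
    (a : Fin d → ℝ) :
    (multivariateGaussian 0 S).map (fun x => ∑ j, x j * a j) =
      gaussianReal 0 (a ⬝ᵥ S.mulVec a).toNNReal := by
  have h1 : (fun x : EuclideanSpace ℝ (Fin d) => ∑ j, x j * a j) =
      innerSL ℝ (WithLp.toLp 2 a : EuclideanSpace ℝ (Fin d)) := by
    ext x
    rw [innerSL_apply_apply, real_inner_comm, real_inner_toLp_right]
  rw [h1, IsGaussian.map_eq_gaussianReal]
  congr 1
  · rw [ContinuousLinearMap.integral_comp_id_comm IsGaussian.integrable_id]
    simp
  · congr 1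
    rw [← covariance_self (by fun_prop), ← covarianceBilin_multivariateGaussian (μ := 0) hS
      (WithLp.toLp 2 a) (WithLp.toLp 2 a), covarianceBilin_apply_eq_cov IsGaussian.memLp_two_id]
    rfl

/-- The squared norm of `u` without its `i`-th coordinate. -/
def restSq {d : ℕ} (u : Fin d → ℝ) (i : Fin d) : ℝ := ∑ j, u (skipIndex i j) ^ 2

lemma restSq_nonneg {d : ℕ} (u : Fin d → ℝ) (i : Fin d) : 0 ≤ restSq u i :=
  Finset.sum_nonneg fun _ _ => sq_nonneg _

lemma sqNorm_eq_add_restSq {d : ℕ} (u : Fin d → ℝ) (i : Fin d) :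
    sqNorm u = u i ^ 2 + restSq u i :=
  sum_eq_add_sum_skipIndex i fun j => u j ^ 2

/-- The coefficients of the regression of coordinate `i` on the others under `N(0, I + θ u uᵀ)`. -/
noncomputable def regCoef {d : ℕ} (θ : ℝ) (u : Fin d → ℝ) (i : Fin d) : Fin (d - 1) → ℝ :=
  fun j => θ * u i / (1 + θ * restSq u i) * u (skipIndex i j)

/-- The standard deviation of the residual of coordinate `i` under `N(0, I + θ u uᵀ)`. -/
noncomputable def residualSd {d : ℕ} (θ : ℝ) (u : Fin d → ℝ) (i : Fin d) : ℝ≥0 :=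
  NNReal.sqrt (1 + θ * u i ^ 2 / (1 + θ * restSq u i)).toNNReal

lemma residualSd_sq {d : ℕ} {θ : ℝ} (hθ : 0 ≤ θ) (u : Fin d → ℝ) (i : Fin d) :
    (residualSd θ u i : ℝ) ^ 2 = 1 + θ * u i ^ 2 / (1 + θ * restSq u i) := by
  have := restSq_nonneg u i
  rw [residualSd, ← NNReal.coe_pow, NNReal.sq_sqrt, Real.coe_toNNReal]
  positivity

lemma one_le_residualSd_sq {d : ℕ} {θ : ℝ} (hθ : 0 ≤ θ) (u : Fin d → ℝ) (i : Fin d) :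
    1 ≤ (residualSd θ u i : ℝ) ^ 2 := by
  have := restSq_nonneg u i
  rw [residualSd_sq hθ, le_add_iff_nonneg_right]
  positivity

lemma residualSd_pos {d : ℕ} {θ : ℝ} (hθ : 0 ≤ θ) (u : Fin d → ℝ) (i : Fin d) :
    0 < residualSd θ u i := by
  rw [pos_iff_ne_zero]
  intro h
  have := one_le_residualSd_sq hθ u i
  rw [h] at this
  norm_num at this

lemma residualSd_sq_le_two {d : ℕ} {θ : ℝ} (hθ : 0 ≤ θ) (hθ1 : θ ≤ 1) {u : Fin d → ℝ}
    (hu : sqNorm u = 1) (i : Fin d) : (residualSd θ u i : ℝ) ^ 2 ≤ 2 := by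
  have h1 := restSq_nonneg u i
  have h2 := sqNorm_eq_add_restSq u i
  rw [residualSd_sq hθ]
  have h3 : θ * u i ^ 2 / (1 + θ * restSq u i) ≤ 1 := by
    rw [div_le_one (by positivity)]
    nlinarith [sq_nonneg (u i), mul_nonneg hθ h1]
  linarith

/-- The law of a row of the data matrix without its `i`-th entry. -/
noncomputable def restLaw {d : ℕ} (θ : ℝ) (u : Fin d → ℝ) (i : Fin d) :
    Measure (Fin (d - 1) → ℝ) :=
  (multivariateGaussian 0 (spikedCov θ u)).map fun x j => x (skipIndex i j)

instance {d : ℕ} (θ : ℝ) (u : Fin d → ℝ) (i : Fin d) : IsProbabilityMeasure (restLaw θ u i) :=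
  Measure.isProbabilityMeasure_map (by fun_prop)

lemma map_residual {d : ℕ} {θ : ℝ} (hθ : 0 ≤ θ) (u : Fin d → ℝ) (i : Fin d) :
    (multivariateGaussian 0 (spikedCov θ u)).map
        (fun x => x i - ∑ j, x (skipIndex i j) * regCoef θ u i j) =
      gaussianReal 0 (residualSd θ u i ^ 2) := by
  have hR := restSq_nonneg u i
  have hpos : 0 < 1 + θ * restSq u i := by positivity
  obtain ⟨a, ha, ha'⟩ : ∃ a : Fin d → ℝ, a i = 1 ∧
      ∀ j, a (skipIndex i j) = -regCoef θ u i j := by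
    refine ⟨fun l => if l = i then 1 else -(θ * u i / (1 + θ * restSq u i) * u l), by simp, ?_⟩
    intro j
    simp [skipIndex_ne, regCoef]
  have h1 : (fun x : EuclideanSpace ℝ (Fin d) =>
      x i - ∑ j, x (skipIndex i j) * regCoef θ u i j) = fun x => ∑ l, x l * a l := by
    ext x
    rw [sum_eq_add_sum_skipIndex i fun l => x l * a l]
    simp [ha, ha', sub_eq_add_neg]
  rw [h1, map_sum_mul_multivariateGaussian (posSemidef_spikedCov hθ u)]
  congr 1
  ext
  rw [NNReal.coe_pow, residualSd_sq hθ, dotProduct_spikedCov_mulVec,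
    sum_eq_add_sum_skipIndex i fun l => a l ^ 2, sum_eq_add_sum_skipIndex i fun l => u l * a l]
  have h2 : ∑ j, a (skipIndex i j) ^ 2 =
      (θ * u i / (1 + θ * restSq u i)) ^ 2 * restSq u i := by
    simp [ha', regCoef, restSq, Finset.mul_sum, mul_pow]
  have h3 : ∑ j, u (skipIndex i j) * a (skipIndex i j) =
      -(θ * u i / (1 + θ * restSq u i) * restSq u i) := by
    simp only [ha', regCoef, restSq, Finset.mul_sum, ← Finset.sum_neg_distrib]
    exact Finset.sum_congr rfl fun j _ => by ring
  rw [h2, h3, ha, Real.coe_toNNReal _ (by positivity)]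
  field_simp
  ring

/-- The other coordinates and the residual are jointly Gaussian, so it is enough that they are
uncorrelated. With `b = θ uᵢ / (1 + θ R)` and `R = restSq u i`, this is `θ uₗ uᵢ = b uₗ (1 + θ R)`.
-/
lemma indepFun_residual {d : ℕ} {θ : ℝ} (hθ : 0 ≤ θ) (u : Fin d → ℝ) (i : Fin d) :
    IndepFun (fun x : EuclideanSpace ℝ (Fin d) => fun j => x (skipIndex i j))
      (fun x => x i - ∑ j, x (skipIndex i j) * regCoef θ u i j)
      (multivariateGaussian 0 (spikedCov θ u)) := by
  have hpos : 0 < 1 + θ * restSq u i := by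
    have := restSq_nonneg u i
    positivity
  have hS := posSemidef_spikedCov hθ u
  have hmem : ∀ l, MemLp (fun x : EuclideanSpace ℝ (Fin d) => x l) 2
      (multivariateGaussian 0 (spikedCov θ u)) := fun l =>
    ((EuclideanSpace.proj l : EuclideanSpace ℝ (Fin d) →L[ℝ] ℝ).comp_memLp'
      IsGaussian.memLp_two_id)
  -- The criterion compares two families of real variables, so the residual is made a family over
  -- `Unit`.
  let Φ : EuclideanSpace ℝ (Fin d) →L[ℝ] (Fin (d - 1) → ℝ) × (Unit → ℝ) :=
    (ContinuousLinearMap.pi fun j => EuclideanSpace.proj (skipIndex i j)).prod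
      (ContinuousLinearMap.pi fun _ => EuclideanSpace.proj i -
        ∑ j, regCoef θ u i j • EuclideanSpace.proj (skipIndex i j))
  have hΦ : HasGaussianLaw (fun x : EuclideanSpace ℝ (Fin d) =>
      ((fun j => x (skipIndex i j)),
        fun _ : Unit => x i - ∑ j, x (skipIndex i j) * regCoef θ u i j))
      (multivariateGaussian 0 (spikedCov θ u)) := by
    have h := (IsGaussian.hasGaussianLaw_id
      (μ := multivariateGaussian 0 (spikedCov θ u))).map_fun Φ
    have hfun : (fun x : EuclideanSpace ℝ (Fin d) => Φ (id x)) = fun x =>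
        ((fun j => x (skipIndex i j)),
          fun _ : Unit => x i - ∑ j, x (skipIndex i j) * regCoef θ u i j) := by
      funext x
      ext
      · simp [Φ]
      · simp [Φ, mul_comm]
    exact hfun ▸ h
  have := hΦ.indepFun_of_covariance_eval
    (X := fun j (x : EuclideanSpace ℝ (Fin d)) => x (skipIndex i j))
    (Y := fun (_ : Unit) (x : EuclideanSpace ℝ (Fin d)) => x i - ∑ j, x (skipIndex i j) * regCoef θ u i j) ?_
  · exact this.comp (φ := id) (ψ := fun y : Unit → ℝ => y ()) measurable_id (by fun_prop)
  · intro j _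
    rw [covariance_fun_sub_right (hmem _) (hmem _)
      (memLp_finsetSum _ fun l _ => (hmem _).mul_const _),
      covariance_fun_sum_right (fun l => (hmem _).mul_const _) (hmem _)]
    simp_rw [covariance_mul_const_right, covariance_eval_multivariateGaussian hS, spikedCov_apply]
    have h1 : ∀ l, (if skipIndex i j = skipIndex i l then (1 : ℝ) else 0) =
        if j = l then 1 else 0 := by
      intro l
      congr 1
      rw [eq_iff_iff]
      constructor
      · intro h
        have := congrArg Fin.val h
        simp only [skipIndex] at this
        ext
        split_ifs at this <;> omega
      · rintro rfl
        rfl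
    simp_rw [h1, add_mul, Finset.sum_add_distrib]
    have h2 : ∑ l, θ * (u (skipIndex i j) * u (skipIndex i l)) * regCoef θ u i l =
        θ * u (skipIndex i j) * (θ * u i / (1 + θ * restSq u i)) * restSq u i := by
      simp only [regCoef, restSq, Finset.mul_sum]
      exact Finset.sum_congr rfl fun l _ => by ring
    rw [h2]
    simp only [skipIndex_ne, if_false, ite_mul, one_mul, zero_mul, Finset.sum_ite_eq,
      Finset.mem_univ, if_true, regCoef]
    field_simp
    ring

lemma measurePreserving_row_split {d : ℕ} {θ : ℝ} (hθ : 0 ≤ θ) (u : Fin d → ℝ) (i : Fin d) :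
    MeasurePreserving (fun x : EuclideanSpace ℝ (Fin d) => ((fun j => x (skipIndex i j)),
        x i - ∑ j, x (skipIndex i j) * regCoef θ u i j))
      (multivariateGaussian 0 (spikedCov θ u))
      ((restLaw θ u i).prod (gaussianReal 0 (residualSd θ u i ^ 2))) where
  measurable := by fun_prop
  map_eq := by
    rw [(indepFun_iff_map_prod_eq_prod_map_map (by fun_prop) (by fun_prop)).1
      (indepFun_residual hθ u i), map_residual hθ]
    rfl

/-- Under `N(0, I + θ u uᵀ)`, the other columns and the residual of the `i`-th column are
independent. -/
lemma measurePreserving_sample_split (n : ℕ) {d : ℕ} {θ : ℝ} (hθ : 0 ≤ θ) (u : Fin d → ℝ)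
    (i : Fin d) :
    MeasurePreserving (fun x : Fin n → EuclideanSpace ℝ (Fin d) =>
        (dropColumn (dataMatrix x) i,
          column (dataMatrix x) i - applyDesign (dropColumn (dataMatrix x) i) (regCoef θ u i)))
      (sampleLaw n d (spikedCov θ u))
      ((Measure.pi fun _ => restLaw θ u i).prod (noiseLaw n (residualSd θ u i))) :=
  (measurePreserving_arrowProdEquivProdArrow _ _ (Fin n) (fun _ => restLaw θ u i)
    (fun _ => gaussianReal 0 (residualSd θ u i ^ 2))).comp
    (measurePreserving_pi _ _ fun _ => measurePreserving_row_split hθ u i)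

/-! ### Conditioning on an exceptional set -/

instance (n : ℕ) (σ : ℝ≥0) : IsProbabilityMeasure (noiseLaw n σ) := by
  unfold noiseLaw
  infer_instance

/-- Fubini, bounding the slices over `N` by 1. The measurable hull of `N` is used in its place, so
the set of bad designs need not be shown measurable. -/
lemma prod_real_le_add {α β : Type*} [MeasurableSpace α] [MeasurableSpace β] {μ : Measure α}
    {ν : Measure β} [IsProbabilityMeasure μ] [IsProbabilityMeasure ν] {A : Set (α × β)}
    (hA : MeasurableSet A) {N : Set α} {a b : ℝ} (hN : μ.real N ≤ a)
    (hb : 0 ≤ b) (h : ∀ x ∉ N, ν.real {y | (x, y) ∈ A} ≤ b) : (μ.prod ν).real A ≤ a + b := by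
  have ha : 0 ≤ a := measureReal_nonneg.trans hN
  refine ENNReal.toReal_le_of_le_ofReal (by positivity) ?_
  rw [Measure.prod_apply hA, ENNReal.ofReal_add ha hb]
  have hM := measurableSet_toMeasurable μ N
  calc ∫⁻ x, ν (Prod.mk x ⁻¹' A) ∂μ
      ≤ ∫⁻ x, (toMeasurable μ N).indicator 1 x + ENNReal.ofReal b ∂μ := by
        refine lintegral_mono fun x => ?_
        by_cases hx : x ∈ toMeasurable μ N
        · rw [Set.indicator_of_mem hx]
          exact prob_le_one.trans le_self_add
        · have := h x fun hx' => hx (subset_toMeasurable μ N hx')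
          refine le_trans ?_ le_add_self
          rw [← ofReal_measureReal]
          exact ENNReal.ofReal_le_ofReal this
    _ = μ N + ENNReal.ofReal b := by
        rw [lintegral_add_right _ measurable_const, lintegral_indicator_one hM, measure_toMeasurable]
        simp
    _ ≤ _ := by
        gcongr
        rw [← ofReal_measureReal]
        exact ENNReal.ofReal_le_ofReal hN

/-! ### Norms of fixed combinations of the columns -/

/-- Each row contributes a Gaussian of variance `‖v‖² + θ ⟨u_{-i}, v⟩²`. Since `θ ≤ 1` and `‖u_{-i}‖
≤ 1`, Cauchy-Schwarz puts it between `‖v‖²` and `2 ‖v‖²`. -/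
lemma exists_map_applyDesign {n d : ℕ} {θ : ℝ} (hθ : 0 ≤ θ) (hθ1 : θ ≤ 1) {u : Fin d → ℝ}
    (hu : sqNorm u = 1) (i : Fin d) (v : Fin (d - 1) → ℝ) :
    ∃ s : ℝ≥0, sqNorm v ≤ (s : ℝ) ^ 2 ∧ (s : ℝ) ^ 2 ≤ 2 * sqNorm v ∧
      MeasurePreserving (fun X : Design n (d - 1) => applyDesign X v)
        (Measure.pi fun _ => restLaw θ u i) (noiseLaw n s) := by
  have hR := restSq_nonneg u i
  have hv := sqNorm_nonneg v
  obtain ⟨a, ha, ha'⟩ : ∃ a : Fin d → ℝ, a i = 0 ∧ ∀ j, a (skipIndex i j) = v j := by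
    obtain _ | d := d
    · exact i.elim0
    refine ⟨i.insertNth 0 v, by simp, fun j => ?_⟩
    have : skipIndex i j = i.succAbove j := by
      ext
      simp only [skipIndex, Fin.succAbove, Fin.lt_def, Fin.val_castSucc]
      split_ifs <;> simp
    rw [this, Fin.insertNth_apply_succAbove]
  set V := a ⬝ᵥ (spikedCov θ u).mulVec a with hV
  have hVeq : V = sqNorm v + θ * (∑ j, u (skipIndex i j) * v j) ^ 2 := by
    rw [hV, dotProduct_spikedCov_mulVec, sum_eq_add_sum_skipIndex i fun l => a l ^ 2,
      sum_eq_add_sum_skipIndex i fun l => u l * a l]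
    simp [ha, ha', sqNorm]
  have hCS : (∑ j, u (skipIndex i j) * v j) ^ 2 ≤ sqNorm v := by
    refine (Finset.sum_mul_sq_le_sq_mul_sq _ _ _).trans ?_
    have h1 : restSq u i ≤ 1 := by
      have := sqNorm_eq_add_restSq u i
      nlinarith [sq_nonneg (u i)]
    exact (mul_le_mul_of_nonneg_right h1 hv).trans_eq (one_mul _)
  have hV0 : 0 ≤ V := by
    rw [hVeq]
    positivity
  refine ⟨NNReal.sqrt V.toNNReal, ?_, ?_, ?_⟩
  · rw [← NNReal.coe_pow, NNReal.sq_sqrt, Real.coe_toNNReal _ hV0, hVeq]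
    exact le_add_of_nonneg_right (by positivity)
  · rw [← NNReal.coe_pow, NNReal.sq_sqrt, Real.coe_toNNReal _ hV0, hVeq]
    nlinarith [sq_nonneg (∑ j, u (skipIndex i j) * v j)]
  · refine measurePreserving_pi (fun _ : Fin n => restLaw θ u i)
      (fun _ => gaussianReal 0 (NNReal.sqrt V.toNNReal ^ 2))
      (f := fun _ x => ∑ j, x j * v j) fun _ => ⟨by fun_prop, ?_⟩
    rw [NNReal.sq_sqrt, ← map_sum_mul_multivariateGaussian (posSemidef_spikedCov hθ u), restLaw,
      Measure.map_map (by fun_prop) (by fun_prop)]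
    congr 1
    ext x
    rw [sum_eq_add_sum_skipIndex i fun l => x l * a l]
    simp [ha, ha']

lemma measurable_sqNorm {m : ℕ} : Measurable (sqNorm : (Fin m → ℝ) → ℝ) := by
  unfold sqNorm
  fun_prop

/-- In law `‖X v‖²` is `s²` times a chi-squared variable. The 2 in the upper bound is the largest
possible variance ratio, which is why the normalization constant `K` has to exceed 2. -/
lemma sqNorm_applyDesign_tail {n d : ℕ} {θ : ℝ} (hθ : 0 ≤ θ) (hθ1 : θ ≤ 1) {u : Fin d → ℝ}
    (hu : sqNorm u = 1) (i : Fin d) {κ : ℝ} (hκ : 1 < κ) (v : Fin (d - 1) → ℝ) :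
    (Measure.pi fun _ : Fin n => restLaw θ u i).real
        {X : Design n (d - 1) | sqNorm (applyDesign X v) < 1 / 2 * n * sqNorm v ∨
          2 * κ * n * sqNorm v < sqNorm (applyDesign X v)} ≤
      Real.exp (-(chiRate (1 / 2) * n)) + Real.exp (-(chiRate κ * n)) := by
  obtain ⟨s, h1, h2, hs⟩ := exists_map_applyDesign (n := n) hθ hθ1 hu i v
  have hv := sqNorm_nonneg v
  have hn : (0 : ℝ) ≤ n := n.cast_nonneg
  have h3 : (Measure.pi fun _ : Fin n => restLaw θ u i).real
        {X : Design n (d - 1) | sqNorm (applyDesign X v) < 1 / 2 * n * sqNorm v ∨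
          2 * κ * n * sqNorm v < sqNorm (applyDesign X v)} =
      (Measure.pi fun _ : Fin n => gaussianReal 0 1).real
        {g | (s : ℝ) ^ 2 * sqNorm g < 1 / 2 * n * sqNorm v ∨
          2 * κ * n * sqNorm v < (s : ℝ) ^ 2 * sqNorm g} := by
    have hm : MeasurableSet {w : Fin n → ℝ | sqNorm w < 1 / 2 * n * sqNorm v ∨
        2 * κ * n * sqNorm v < sqNorm w} :=
      (measurableSet_lt measurable_sqNorm measurable_const).union
        (measurableSet_lt measurable_const measurable_sqNorm)
    have h4 := hs.measureReal_preimage hm.nullMeasurableSet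
    rw [← map_smul_pi_gaussianReal, map_measureReal_apply (by fun_prop) hm] at h4
    simp only [Set.preimage_ofPred_eq, sqNorm_smul] at h4
    exact h4
  rw [h3]
  refine (measureReal_mono (s₂ := {g : Fin n → ℝ | ∑ a, g a ^ 2 ≤ (1 / 2 : ℝ) * Fintype.card (Fin n)} ∪
    {g | κ * Fintype.card (Fin n) ≤ ∑ a, g a ^ 2}) ?_ (measure_ne_top _ _)).trans
    ((measureReal_union_le _ _).trans (add_le_add ?_ ?_))
  · rintro g (hg | hg)
    · left
      change sqNorm g ≤ _
      rw [Fintype.card_fin]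
      by_contra! hlt
      have h5 : sqNorm v * (1 / 2 * n) ≤ (s : ℝ) ^ 2 * sqNorm g :=
        mul_le_mul h1 hlt.le (by positivity) (by positivity)
      linarith
    · right
      change _ ≤ sqNorm g
      rw [Fintype.card_fin]
      by_contra! hlt
      have h5 : (s : ℝ) ^ 2 * sqNorm g ≤ 2 * sqNorm v * (κ * n) :=
        mul_le_mul h2 hlt.le (sqNorm_nonneg g) (by positivity)
      linarith
  · simpa using sum_sq_gaussian_le_le_chiRate (ι := Fin n) (κ := 1 / 2) (by norm_num) (by norm_num)
  · simpa using sum_sq_gaussian_ge_le_chiRate (ι := Fin n) hκ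

/-! ### Restricted eigenvalues of the design -/

/-- The bilinear form of the quadratic form `r ‖X x‖² + t ‖x‖²`. -/
noncomputable def designForm {n p : ℕ} (X : Design n p) (r t : ℝ) :
    LinearMap.BilinForm ℝ (Fin p → ℝ) :=
  LinearMap.mk₂ ℝ
    (fun x y => r * ∑ a, applyDesign X x a * applyDesign X y a + t * ∑ j, x j * y j)
    (fun x y z => by
      simp only [applyDesign, Pi.add_apply, mul_add, add_mul, Finset.sum_add_distrib]
      ring)
    (fun c x y => by
      simp only [applyDesign_smul, Pi.smul_apply, smul_eq_mul, mul_assoc, ← Finset.mul_sum]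
      ring)
    (fun x y z => by
      simp only [applyDesign, Pi.add_apply, mul_add, Finset.sum_add_distrib]
      ring)
    (fun c x y => by
      simp only [applyDesign_smul, Pi.smul_apply, smul_eq_mul, mul_left_comm _ c, ← Finset.mul_sum]
      ring)

lemma designForm_self {n p : ℕ} (X : Design n p) (r t : ℝ) (x : Fin p → ℝ) :
    designForm X r t x x = r * sqNorm (applyDesign X x) + t * sqNorm x := by
  simp only [designForm, LinearMap.mk₂_apply, sqNorm, sq]

lemma designForm_isSymm {n p : ℕ} (X : Design n p) (r t : ℝ) : (designForm X r t).IsSymm :=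
  ⟨fun x y => by
    simp only [designForm, LinearMap.mk₂_apply]
    simp_rw [fun a => mul_comm (applyDesign X x a), fun j => mul_comm (x j)]⟩

lemma sqNorm_single {p : ℕ} (j : Fin p) : sqNorm (Pi.single j 1 : Fin p → ℝ) = 1 := by
  simp [sqNorm, Pi.single_apply]

lemma sum_abs_single {p : ℕ} (j : Fin p) : ∑ l, |(Pi.single j 1 : Fin p → ℝ) l| = 1 := by
  rw [Finset.sum_eq_single j] <;> simp +contextual

lemma sq_sum_abs_le {p : ℕ} (S : Finset (Fin p)) (x : Fin p → ℝ) :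
    (∑ j ∈ S, |x j|) ^ 2 ≤ S.card * sqNorm x := by
  refine sq_sum_le_card_mul_sum_sq.trans ?_
  gcongr
  simp_rw [sq_abs]
  exact Finset.sum_le_univ_sum_of_nonneg fun j => sq_nonneg (x j)

lemma sq_sum_abs_le_hammingNorm {p : ℕ} (x : Fin p → ℝ) :
    (∑ j, |x j|) ^ 2 ≤ hammingNorm x * sqNorm x := by
  have h : ∑ j, |x j| = ∑ j with x j ≠ 0, |x j| := by
    rw [Finset.sum_filter_of_ne]
    intro j _ h h0
    simp [h0] at h
  rw [h]
  exact sq_sum_abs_le _ x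

lemma sq_sum_abs_le_of_mem_reCone {p k : ℕ} {S : Finset (Fin p)} (hS : S.card = k)
    {x : Fin p → ℝ} (hx : x ∈ reCone S) : (∑ j, |x j|) ^ 2 ≤ 16 * k * sqNorm x := by
  have h1 : ∑ j, |x j| ≤ 4 * ∑ j ∈ S, |x j| := by
    rw [← Finset.sum_add_sum_compl S fun j => |x j|]
    have : ∑ j ∈ Sᶜ, |x j| ≤ 3 * ∑ j ∈ S, |x j| := hx
    linarith
  have h2 : 0 ≤ ∑ j, |x j| := Finset.sum_nonneg fun _ _ => abs_nonneg _
  have h3 := sq_sum_abs_le S x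
  rw [hS] at h3
  calc (∑ j, |x j|) ^ 2 ≤ (4 * ∑ j ∈ S, |x j|) ^ 2 := pow_le_pow_left₀ h2 h1 2
    _ = 16 * (∑ j ∈ S, |x j|) ^ 2 := by ring
    _ ≤ _ := by linarith

/-- The design is well conditioned on the sums of `m` signed basis vectors. -/
def WellConditionedOnAtoms {n p : ℕ} (κ : ℝ) (m : ℕ) (X : Design n p) : Prop :=
  ∀ f : Fin m → Fin p × Bool, 1 / 2 * n * sqNorm (atom f) ≤ sqNorm (applyDesign X (atom f)) ∧
    sqNorm (applyDesign X (atom f)) ≤ 2 * κ * n * sqNorm (atom f)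

section WellConditioned

variable {n p m : ℕ} {κ : ℝ} {X : Design n p}

/-- Transfer for the form `2κn ‖x‖² - ‖X x‖²`, whose diagonal is at most `2κn`. Using `m + 1`
summands makes the factor exactly `m`. -/
lemma WellConditionedOnAtoms.upper (hX : WellConditionedOnAtoms κ (m + 1) X) (x : Fin p → ℝ) :
    m * sqNorm (applyDesign X x) ≤ 2 * κ * n * (m * sqNorm x + (∑ j, |x j|) ^ 2) := by
  have h := nonneg_of_atoms m.succ_pos (designForm X (-1) (2 * κ * n))
    (designForm_isSymm _ _ _) (D := 2 * κ * n)
    (fun j => by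
      rw [designForm_self, sqNorm_single]
      linarith [sqNorm_nonneg (applyDesign X (Pi.single j 1))])
    (fun f => by
      rw [designForm_self]
      linarith [(hX f).2]) x
  rw [designForm_self] at h
  push_cast at h
  linarith

/-- Transfer for the form `‖X x‖² - n ‖x‖² / 2`. Its diagonal is bounded by the upper estimate at
basis vectors, where `(m + 1) / m ≤ 2` gives `4κn`. -/
lemma WellConditionedOnAtoms.lower (hκ : 0 ≤ κ) (hm : 1 ≤ m)
    (hX : WellConditionedOnAtoms κ (m + 1) X) (x : Fin p → ℝ) :
    n * (1 / 2 * m * sqNorm x - 4 * κ * (∑ j, |x j|) ^ 2) ≤ m * sqNorm (applyDesign X x) := by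
  have hm' : (1 : ℝ) ≤ m := by exact_mod_cast hm
  have h := nonneg_of_atoms m.succ_pos (designForm X 1 (-(1 / 2 * n)))
    (designForm_isSymm _ _ _) (D := 4 * κ * n)
    (fun j => by
      have h1 := hX.upper (Pi.single j 1)
      rw [sqNorm_single, sum_abs_single] at h1
      have h2 : m * sqNorm (applyDesign X (Pi.single j 1)) ≤ m * (4 * κ * n) := by
        refine h1.trans ?_
        have : 0 ≤ κ * n := by positivity
        nlinarith
      have h3 := le_of_mul_le_mul_left h2 (by linarith)
      rw [designForm_self, sqNorm_single]
      have : (0 : ℝ) ≤ n := n.cast_nonneg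
      linarith)
    (fun f => by
      rw [designForm_self]
      linarith [(hX f).1]) x
  rw [designForm_self] at h
  push_cast at h
  linarith

variable {k M : ℕ}

/-- The `ℓ¹` correction is at most `4κ · 16k ‖x‖²`, and `M ≥ 256κ` makes it at most `kM ‖x‖² / 4`,
half of the main term. -/
lemma WellConditionedOnAtoms.quarter_le (hκ : 0 ≤ κ) (hk : 1 ≤ k) (hM : 256 * κ ≤ M)
    (hM1 : 1 ≤ M) (hX : WellConditionedOnAtoms κ (k * M + 1) X) {x : Fin p → ℝ}
    (hx : (∑ j, |x j|) ^ 2 ≤ 16 * k * sqNorm x) :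
    1 / 4 * n * sqNorm x ≤ sqNorm (applyDesign X x) := by
  have hkM : 1 ≤ k * M := Nat.mul_pos hk hM1
  have hpos : (0 : ℝ) < ((k * M : ℕ) : ℝ) := by exact_mod_cast hkM
  refine le_of_mul_le_mul_left (le_trans ?_ (hX.lower hκ hkM x)) hpos
  have h1 : 4 * κ * (∑ j, |x j|) ^ 2 ≤ 4 * κ * (16 * k * sqNorm x) := by gcongr
  have h2 : k * sqNorm x * (256 * κ) ≤ k * sqNorm x * M :=
    mul_le_mul_of_nonneg_left hM (mul_nonneg k.cast_nonneg (sqNorm_nonneg x))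
  have h3 : ((k * M : ℕ) : ℝ) * (1 / 4 * n * sqNorm x) =
      n * (1 / 4 * ((k * M : ℕ) : ℝ) * sqNorm x) := by ring
  rw [h3]
  refine mul_le_mul_of_nonneg_left ?_ n.cast_nonneg
  push_cast
  linarith

/-- With `κ = (K + 2) / 4` the bound on atoms is `2κ`, the midpoint of 2 and `K`. The `ℓ¹`
correction on `2k`-sparse vectors multiplies it by `1 + 2 / M`, which stays below `K` exactly under
the condition on `M`. -/
lemma WellConditionedOnAtoms.isNormalized {K : ℝ} (hK : 2 < K) (hn : 0 < n) (hk : 1 ≤ k)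
    (hM : 2 * (K + 2) / (K - 2) ≤ M) (hM1 : 1 ≤ M)
    (hX : WellConditionedOnAtoms ((K + 2) / 4) (k * M + 1) X) : IsNormalized K X k := by
  intro x hx
  have hn' : (0 : ℝ) < n := by exact_mod_cast hn
  have hpos : (0 : ℝ) < ((k * M : ℕ) : ℝ) := by exact_mod_cast Nat.mul_pos hk hM1
  have hx0 := sqNorm_nonneg x
  rw [div_le_iff₀ hn']
  refine le_of_mul_le_mul_left ((hX.upper x).trans ?_) hpos
  have h1 : (∑ j, |x j|) ^ 2 ≤ 2 * k * sqNorm x := by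
    refine (sq_sum_abs_le_hammingNorm x).trans (mul_le_mul_of_nonneg_right ?_ hx0)
    exact_mod_cast hx
  rw [div_le_iff₀ (by linarith)] at hM
  have h2 : k * sqNorm x * (2 * (K + 2)) ≤ k * sqNorm x * (M * (K - 2)) :=
    mul_le_mul_of_nonneg_left hM (by positivity)
  have h3 : (K + 2) * (∑ j, |x j|) ^ 2 ≤ (K + 2) * (2 * k * sqNorm x) := by
    gcongr
  have h4 : 2 * ((K + 2) / 4) * ((k * M : ℕ) * sqNorm x + (∑ j, |x j|) ^ 2) ≤
      (k * M : ℕ) * (K * sqNorm x) := by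
    push_cast
    linarith
  calc _ = n * (2 * ((K + 2) / 4) * ((k * M : ℕ) * sqNorm x + (∑ j, |x j|) ^ 2)) := by ring
    _ ≤ n * ((k * M : ℕ) * (K * sqNorm x)) := mul_le_mul_of_nonneg_left h4 hn'.le
    _ = _ := by ring

/-- The supremum needs a bounded set. A basis vector supported in some `S` of size `k` lies in its
cone and bounds every admissible `γ`; this is where `1 ≤ k ≤ p` enters. -/
lemma le_restrictedEigenvalue (hk : 1 ≤ k) (hkp : k ≤ p) {γ : ℝ}
    (h : ∀ S : Finset (Fin p), S.card = k → ∀ β ∈ reCone S,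
      γ * sqNorm β ≤ sqNorm (applyDesign X β) / n) : γ ≤ restrictedEigenvalue X k := by
  refine le_csSup ?_ h
  obtain ⟨S, -, hS⟩ := Finset.exists_superset_card_eq (s := (∅ : Finset (Fin p))) (n := k)
    (by simp) (by simpa using hkp)
  obtain ⟨j, hj⟩ : S.Nonempty := Finset.card_pos.1 (by omega)
  refine ⟨sqNorm (applyDesign X (Pi.single j 1)) / n, fun γ' hγ' => ?_⟩
  have := hγ' S hS (Pi.single j 1) ?_
  · rwa [sqNorm_single, mul_one] at this
  · change ∑ l ∈ Sᶜ, |(Pi.single j 1 : Fin p → ℝ) l| ≤ _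
    rw [Finset.sum_eq_zero]
    · positivity
    · intro l hl
      have : l ≠ j := by
        rintro rfl
        exact Finset.mem_compl.1 hl hj
      simp [this]

lemma WellConditionedOnAtoms.quarter_le_restrictedEigenvalue (hκ : 0 ≤ κ) (hn : 0 < n)
    (hk : 1 ≤ k) (hkp : k ≤ p) (hM : 256 * κ ≤ M) (hM1 : 1 ≤ M)
    (hX : WellConditionedOnAtoms κ (k * M + 1) X) : 1 / 4 ≤ restrictedEigenvalue X k := by
  have hn' : (0 : ℝ) < n := by exact_mod_cast hn
  refine le_restrictedEigenvalue hk hkp fun S hS β hβ => ?_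
  rw [le_div_iff₀ hn']
  have := hX.quarter_le hκ hk hM hM1 (sq_sum_abs_le_of_mem_reCone hS hβ)
  linarith

end WellConditioned

lemma not_wellConditionedOnAtoms_le {n d m : ℕ} {θ : ℝ} (hθ : 0 ≤ θ) (hθ1 : θ ≤ 1)
    {u : Fin d → ℝ} (hu : sqNorm u = 1) (i : Fin d) {κ : ℝ} (hκ : 1 < κ) :
    (Measure.pi fun _ : Fin n => restLaw θ u i).real
        {X : Design n (d - 1) | ¬ WellConditionedOnAtoms κ m X} ≤
      (2 * d : ℝ) ^ m * (Real.exp (-(chiRate (1 / 2) * n)) + Real.exp (-(chiRate κ * n))) := by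
  refine (measureReal_mono (s₂ := ⋃ f ∈ (Finset.univ : Finset (Fin m → Fin (d - 1) × Bool)),
    {X : Design n (d - 1) | sqNorm (applyDesign X (atom f)) < 1 / 2 * n * sqNorm (atom f) ∨
      2 * κ * n * sqNorm (atom f) < sqNorm (applyDesign X (atom f))}) ?_
    (measure_ne_top _ _)).trans ((measureReal_biUnion_finset_le _ _).trans
    ((Finset.sum_le_sum fun f _ => sqNorm_applyDesign_tail hθ hθ1 hu i hκ (atom f)).trans ?_))
  · intro X hX
    change ¬ ∀ _, _ at hX
    push Not at hX
    obtain ⟨f, hf⟩ := hX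
    simp only [Set.mem_iUnion, Finset.mem_univ]
    refine ⟨f, trivial, ?_⟩
    rcases lt_or_ge (sqNorm (applyDesign X (atom f))) (1 / 2 * n * sqNorm (atom f)) with h | h
    · exact Or.inl h
    · exact Or.inr (hf h)
  · rw [Finset.sum_const, nsmul_eq_mul]
    refine mul_le_mul_of_nonneg_right ?_ (by positivity)
    simp only [Finset.card_univ, Fintype.card_pi, Fintype.card_prod, Fintype.card_fin,
      Fintype.card_bool, Finset.prod_const]
    push_cast
    refine pow_le_pow_left₀ (by positivity) ?_ m
    have : ((d - 1 : ℕ) : ℝ) ≤ d := by exact_mod_cast Nat.sub_le d 1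
    linarith

/-! ### Error probabilities of the test -/

/-- The decrease of the mean squared error achieved by the black box. -/
noncomputable def fitGain (SLR : Solver) {n p : ℕ} (X : Design n p) (y : Fin n → ℝ) (k : ℕ) : ℝ :=
  sqNorm y / n - sqNorm (y - applyDesign X (SLR n p y X k)) / n

lemma sqNorm_sub_sqNorm_sub {m : ℕ} (y v : Fin m → ℝ) :
    sqNorm y - sqNorm (y - v) = 2 * ∑ a, y a * v a - sqNorm v := by
  simp only [sqNorm, Finset.mul_sum, ← Finset.sum_sub_distrib, Pi.sub_apply]
  exact Finset.sum_congr rfl fun a _ => by ring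

lemma measurable_applyDesign {n p : ℕ} :
    Measurable fun q : Design n p × (Fin p → ℝ) => applyDesign q.1 q.2 := by
  unfold applyDesign
  fun_prop

lemma measurable_fitGain {SLR : Solver} {K c c' c'' : ℝ} (h : BlackBoxCondition SLR K c c' c'')
    (n p k : ℕ) :
    Measurable fun q : Design n p × (Fin n → ℝ) => fitGain SLR q.1 q.2 k := by
  have h1 : Measurable fun q : Design n p × (Fin n → ℝ) => SLR n p q.2 q.1 k :=
    (h.measurable n p k).comp measurable_swap
  have h2 : Measurable fun q : Design n p × (Fin n → ℝ) =>
      applyDesign q.1 (SLR n p q.2 q.1 k) :=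
    measurable_applyDesign.comp (measurable_fst.prodMk h1)
  exact ((measurable_sqNorm.comp measurable_snd).div_const _).sub
    ((measurable_sqNorm.comp (measurable_snd.sub h2)).div_const _)

/-- The passage from random to fixed design: given `X_{-i}` outside `N`, column `i` is a regression
response with independent noise, so fixed-design bounds apply slice by slice. -/
lemma sampleLaw_real_le_add {n d : ℕ} {θ : ℝ} (hθ : 0 ≤ θ) (u : Fin d → ℝ) (i : Fin d)
    {A : Set (Design n (d - 1) × (Fin n → ℝ))} (hA : MeasurableSet A)
    {N : Set (Design n (d - 1))} {a b : ℝ}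
    (hN : (Measure.pi fun _ : Fin n => restLaw θ u i).real N ≤ a) (hb : 0 ≤ b)
    (h : ∀ X ∉ N, (noiseLaw n (residualSd θ u i)).real
      {w | (X, applyDesign X (regCoef θ u i) + w) ∈ A} ≤ b) :
    (sampleLaw n d (spikedCov θ u)).real
      {x | (dropColumn (dataMatrix x) i, column (dataMatrix x) i) ∈ A} ≤ a + b := by
  have hm : Measurable fun q : Design n (d - 1) × (Fin n → ℝ) =>
      (q.1, applyDesign q.1 (regCoef θ u i) + q.2) :=
    measurable_fst.prodMk
      ((measurable_applyDesign.comp (measurable_fst.prodMk measurable_const)).add measurable_snd)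
  have h1 := (measurePreserving_sample_split n hθ u i).measureReal_preimage
    (hm hA).nullMeasurableSet
  have h2 := prod_real_le_add (hm hA) hN hb h
  rw [← h1] at h2
  simpa only [← Set.preimage_comp, Function.comp_def, add_sub_cancel, Set.preimage,
    Set.mem_ofPred_eq] using h2

lemma spikedCov_zero {d : ℕ} (u : Fin d → ℝ) : spikedCov 0 u = 1 := by
  simp [spikedCov]

lemma qTest_eq_one_iff (SLR : Solver) {n d : ℕ} (X : Design n d) (k : ℕ) :
    qTest SLR X k = 1 ↔ ∃ i : Fin d, qThreshold n d k < qStat SLR X k i := by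
  unfold qTest
  split_ifs with h <;> simp [h]

lemma qTest_eq_zero_iff (SLR : Solver) {n d : ℕ} (X : Design n d) (k : ℕ) :
    qTest SLR X k = 0 ↔ ∀ i : Fin d, qStat SLR X k i ≤ qThreshold n d k := by
  unfold qTest
  split_ifs with h
  · simpa using h
  · simpa using h

instance (n d : ℕ) (Γ : Matrix (Fin d) (Fin d) ℝ) : IsProbabilityMeasure (sampleLaw n d Γ) := by
  unfold sampleLaw
  infer_instance

lemma typeIError_le_choose {SLR : Solver} {K c c' c'' : ℝ} (h : BlackBoxCondition SLR K c c' c'')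
    {n d k : ℕ} (hn : 0 < n) (hkd : k ≤ d - 1) :
    typeIError SLR n d k ≤
      d * ((d - 1).choose k * (2 ^ k * Real.exp (-(3 / 8 * (13 * k * Real.log (d / k)))))) := by
  have hn' : (0 : ℝ) < n := by exact_mod_cast hn
  calc typeIError SLR n d k
      ≤ (sampleLaw n d 1).real (⋃ i ∈ (Finset.univ : Finset (Fin d)),
          {x | qThreshold n d k < qStat SLR (dataMatrix x) k i}) := by
        refine measureReal_mono ?_ (measure_ne_top _ _)
        intro x hx
        obtain ⟨i, hi⟩ := (qTest_eq_one_iff _ _ _).1 hx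
        simp only [Set.mem_iUnion, Finset.mem_univ]
        exact ⟨i, trivial, hi⟩
    _ ≤ ∑ i : Fin d, (0 + (d - 1).choose k *
          (2 ^ k * Real.exp (-(3 / 8 * (13 * k * Real.log (d / k)))))) := by
        refine (measureReal_biUnion_finset_le _ _).trans (Finset.sum_le_sum fun i _ => ?_)
        -- The null hypothesis is the spiked model with `θ = 0`: zero coefficients and residual
        -- variance 1. No design has to be excluded, hence `N = ∅`.
        rw [← spikedCov_zero (0 : Fin d → ℝ)]
        refine sampleLaw_real_le_add le_rfl 0 i
          (A := {q | qThreshold n d k < fitGain SLR q.1 q.2 k})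
          (measurableSet_lt measurable_const (measurable_fitGain h _ _ _)) (N := ∅) (by simp)
          (by positivity) fun X _ => ?_
        refine le_trans (measureReal_mono ?_ (measure_ne_top _ _))
          (noiseLaw_sparse_tail X hkd (residualSd_pos le_rfl 0 i) _)
        intro w hw
        have h0 : applyDesign X (regCoef 0 (0 : Fin d → ℝ) i) + w = w := by
          ext a
          simp [applyDesign, regCoef]
        change qThreshold n d k < fitGain SLR X _ k at hw
        rw [h0, fitGain, qThreshold, ← sub_div, div_lt_div_iff_of_pos_right hn',
          sqNorm_sub_sqNorm_sub] at hw
        refine ⟨SLR n (d - 1) w X k, h.sparse _ _ _ _ _, ?_⟩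
        rw [residualSd_sq le_rfl]
        simpa using hw
    _ = _ := by simp

/-- The usual `(e d / k)^k` bound, from `k^k / k! ≤ e^k`. -/
lemma choose_le_exp {d k : ℕ} (hk : 1 ≤ k) (hd : 1 ≤ d) :
    ((d - 1).choose k : ℝ) ≤ Real.exp (k * Real.log (d / k) + k) := by
  have hk' : (0 : ℝ) < k := by exact_mod_cast hk
  have hd' : (0 : ℝ) < d := by exact_mod_cast hd
  calc ((d - 1).choose k : ℝ) ≤ ((d - 1 : ℕ) : ℝ) ^ k / k.factorial :=
        Nat.choose_le_pow_div k (d - 1)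
    _ ≤ (d : ℝ) ^ k / k.factorial := by
        gcongr
        exact Nat.sub_le d 1
    _ = (d / k : ℝ) ^ k * ((k : ℝ) ^ k / k.factorial) := by
        rw [div_pow]
        field_simp
    _ ≤ (d / k : ℝ) ^ k * Real.exp k := by
        gcongr
        exact Real.pow_div_factorial_le_exp _ k.cast_nonneg k
    _ = _ := by
        rw [Real.exp_add, Real.exp_nat_mul, Real.exp_log (by positivity)]

/-! ### Arithmetic of the type I union bound -/

section Sizes

variable {d k : ℕ}

lemma one_le_log_div (hk : 1 ≤ k) (hd : Real.exp 1 * k ≤ d) : 1 ≤ Real.log (d / k) := by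
  have hk' : (0 : ℝ) < k := by exact_mod_cast hk
  rw [Real.le_log_iff_exp_le (div_pos (lt_of_lt_of_le (by positivity) hd) hk'), le_div_iff₀ hk']
  exact hd

/-- Here `log k ≤ k - 1` and `log (d / k) ≥ 1`. It absorbs the factor `d` from the union over
columns. -/
lemma log_le_mul_log_div (hk : 1 ≤ k) (hd : Real.exp 1 * k ≤ d) :
    Real.log d ≤ k * Real.log (d / k) := by
  have hk' : (1 : ℝ) ≤ k := by exact_mod_cast hk
  have hd' : (0 : ℝ) < d := lt_of_lt_of_le (by positivity) hd
  have h1 := one_le_log_div hk hd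
  have h2 : Real.log d = Real.log (d / k) + Real.log k := by
    rw [Real.log_div hd'.ne' (by positivity)]
    ring
  have h3 := Real.log_le_sub_one_of_pos (by positivity : (0 : ℝ) < k)
  nlinarith

/-- An integer form of `d ≥ e k`, from which `omega` derives `2k ≤ d - 1` and `d ≥ 3` when `k ≥ 1`.
-/
lemma mul_le_mul_of_exp_one_mul_le (hd : Real.exp 1 * k ≤ d) : 27 * k ≤ 10 * d := by
  have h1 := Real.exp_one_gt_d9
  have h2 : (2.7 : ℝ) * k ≤ Real.exp 1 * k := by
    gcongr
    linarith
  have : (27 * k : ℝ) ≤ 10 * d := by linarith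
  exact_mod_cast this

lemma choose_mul_exp_le (hk : 1 ≤ k) (hd : Real.exp 1 * k ≤ d) :
    d * ((d - 1).choose k * (2 ^ k * Real.exp (-(3 / 8 * (13 * k * Real.log (d / k)))))) ≤
      Real.exp (-(1 / 2 * (k * Real.log (d / k)))) := by
  have hk' : (1 : ℝ) ≤ k := by exact_mod_cast hk
  have hd' : (0 : ℝ) < d := lt_of_lt_of_le (by positivity) hd
  have h1 := one_le_log_div hk hd
  have h2 := log_le_mul_log_div hk hd
  have h3 : (2 : ℝ) ^ k ≤ Real.exp k := by
    rw [← mul_one (k : ℝ), Real.exp_nat_mul]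
    gcongr
    have := Real.exp_one_gt_d9
    linarith
  calc _ ≤ Real.exp (Real.log d) * (Real.exp (k * Real.log (d / k) + k) *
        (Real.exp k * Real.exp (-(3 / 8 * (13 * k * Real.log (d / k)))))) := by
        rw [Real.exp_log hd']
        gcongr
        exact choose_le_exp hk (by exact_mod_cast hd')
    _ ≤ _ := by
        rw [← Real.exp_add, ← Real.exp_add, ← Real.exp_add]
        apply Real.exp_le_exp.2
        -- With `L = log (d / k) ≥ 1`, the four factors cost at most `kL`, `kL + k` and `k`, in
        -- total `4kL`. The tail gives `3/8 · 13 = 39/8`, leaving `7/8 ≥ 1/2`; this accounts for the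
        -- 13 in the threshold.
        nlinarith

end Sizes

lemma typeIError_le {SLR : Solver} {K c c' c'' : ℝ} (h : BlackBoxCondition SLR K c c' c'')
    {n d k : ℕ} (hn : 0 < n) (hk : 1 ≤ k) (hd : Real.exp 1 * k ≤ d) :
    typeIError SLR n d k ≤ Real.exp (-(1 / 2 * (k * Real.log (d / k)))) := by
  have := mul_le_mul_of_exp_one_mul_le hd
  exact (typeIError_le_choose h hn (by omega)).trans (choose_mul_exp_le hk hd)

/-! ### Type II error: signal strength and gain of the fit -/

lemma hammingNorm_sub_le {p : ℕ} (x y : Fin p → ℝ) :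
    hammingNorm (x - y) ≤ hammingNorm x + hammingNorm y := by
  have h := hammingDist_triangle y 0 x
  rw [hammingDist_zero_right, hammingDist_zero_left, add_comm] at h
  rwa [sub_eq_neg_add, ← hammingDist_eq_hammingNorm]

/-- A lower bound on the gain of a fit with small prediction error. -/
lemma le_sqNorm_sub_sqNorm {n p k : ℕ} {X : Design n p} {w : Fin n → ℝ} {β b : Fin p → ℝ}
    {R E : ℝ} (hβ : hammingNorm β ≤ k) (hb : hammingNorm b ≤ k)
    (hR : ∀ x : Fin p → ℝ, hammingNorm x ≤ 2 * k →
      2 * ∑ a, w a * applyDesign X x a - sqNorm (applyDesign X x) ≤ R)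
    (hE : sqNorm (applyDesign X b - applyDesign X β) ≤ E) :
    1 / 2 * sqNorm (applyDesign X β) - 2 * E - 3 * R ≤
      sqNorm (applyDesign X β + w) - sqNorm (applyDesign X β + w - applyDesign X b) := by
  set v := applyDesign X β
  set z := applyDesign X b
  -- Taking `x = β - b` bounds the noise against the prediction error by `R` plus that error; taking
  -- `x = -β / 2` gives `2⟨w, v⟩ ≥ -‖v‖² / 2 - 2R`.
  have h1 := hR (β - b) ((hammingNorm_sub_le β b).trans (by omega))
  have h2 := hR ((-(1 / 2) : ℝ) • β) ((hammingNorm_smul_le_hammingNorm).trans (by omega))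
  rw [applyDesign_sub] at h1
  rw [applyDesign_smul, sqNorm_smul] at h2
  change 2 * ∑ a, w a * (v - z) a - sqNorm (v - z) ≤ R at h1
  change 2 * ∑ a, w a * ((-(1 / 2) : ℝ) • v) a - (-(1 / 2)) ^ 2 * sqNorm v ≤ R at h2
  have h3 : ∑ a, w a * ((-(1 / 2) : ℝ) • v) a = -(1 / 2) * ∑ a, w a * v a := by
    rw [Finset.mul_sum]
    exact Finset.sum_congr rfl fun a _ => by simp [mul_left_comm]
  have h4 : sqNorm (v + w) - sqNorm (v + w - z) =
      sqNorm v + 2 * ∑ a, w a * v a - 2 * ∑ a, w a * (v - z) a - sqNorm (v - z) := by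
    simp only [sqNorm, Finset.mul_sum, ← Finset.sum_sub_distrib, ← Finset.sum_add_distrib,
      Pi.sub_apply, Pi.add_apply]
    exact Finset.sum_congr rfl fun a _ => by ring
  have h5 : sqNorm (v - z) = sqNorm (z - v) := by
    rw [← neg_sub, ← neg_one_smul ℝ, sqNorm_smul]
    norm_num
  rw [h3] at h2
  rw [h4]
  rw [h5] at h1 ⊢
  linarith

lemma skipIndex_injective {d : ℕ} (i : Fin d) : Function.Injective (skipIndex i) := by
  intro j l h
  have := congrArg Fin.val h
  simp only [skipIndex] at this
  ext
  split_ifs at this <;> omega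

lemma hammingNorm_regCoef_le {d : ℕ} (θ : ℝ) (u : Fin d → ℝ) (i : Fin d) :
    hammingNorm (regCoef θ u i) ≤ hammingNorm u := by
  classical
  unfold hammingNorm
  rw [← Finset.card_image_of_injective _ (skipIndex_injective i)]
  refine Finset.card_le_card fun l hl => ?_
  obtain ⟨j, hj, rfl⟩ := Finset.mem_image.1 hl
  simp only [Finset.mem_filter, Finset.mem_univ, true_and] at hj ⊢
  exact fun h0 => hj (by simp [regCoef, h0])

/-- The squared norm is `θ² uᵢ² (1 - uᵢ²) / (1 + θ R)²` with `R = restSq u i`. Of `uᵢ²` and `1 -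
uᵢ²`, both are at least `cmin² / k` and one is at least `1/2`; the denominator is at most 4. -/
lemma le_sqNorm_regCoef {d k : ℕ} {θ cmin : ℝ} (hk : 1 ≤ k) (hθ : 0 ≤ θ) (hθ1 : θ ≤ 1)
    {u : Fin d → ℝ} (hu : sqNorm u = 1) {i : Fin d} (h1 : cmin ^ 2 / k ≤ u i ^ 2)
    (h2 : u i ^ 2 ≤ 1 - cmin ^ 2 / k) :
    θ ^ 2 * cmin ^ 2 / (8 * k) ≤ sqNorm (regCoef θ u i) := by
  have hk' : (0 : ℝ) < k := by exact_mod_cast hk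
  have hR := restSq_nonneg u i
  have hR1 : restSq u i = 1 - u i ^ 2 := by linarith [sqNorm_eq_add_restSq u i]
  have hb : regCoef θ u i = (θ * u i / (1 + θ * restSq u i)) • fun j => u (skipIndex i j) := rfl
  have hr : sqNorm (fun j => u (skipIndex i j)) = restSq u i := rfl
  rw [hb, sqNorm_smul, hr]
  set q := cmin ^ 2 / k with hq
  have hq0 : 0 ≤ q := by positivity
  have hq2 : q / 2 ≤ u i ^ 2 * restSq u i := by
    rw [hR1]
    nlinarith
  have hden : 1 + θ * restSq u i ≤ 2 := by nlinarith [sq_nonneg (u i)]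
  have hden0 : 0 < 1 + θ * restSq u i := by positivity
  calc θ ^ 2 * cmin ^ 2 / (8 * k) = θ ^ 2 * (q / 2) / 2 ^ 2 := by
        rw [hq]
        field_simp
        norm_num
    _ ≤ θ ^ 2 * (u i ^ 2 * restSq u i) / (1 + θ * restSq u i) ^ 2 := by gcongr
    _ = _ := by field_simp

lemma log_div_le_log {d k : ℕ} (hk : 1 ≤ k) (hd : 1 ≤ d) : Real.log (d / k) ≤ Real.log d := by
  have hk' : (1 : ℝ) ≤ k := by exact_mod_cast hk
  have hd' : (1 : ℝ) ≤ d := by exact_mod_cast hd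
  exact Real.log_le_log (by positivity) (div_le_self (by linarith) hk')

lemma log_sub_one_le {d : ℕ} (hd : 3 ≤ d) :
    Real.log ((d - 1 : ℕ) : ℝ) ≤ Real.log d ∧ Real.log d ≤ 2 * Real.log ((d - 1 : ℕ) : ℝ) := by
  have h1 : (0 : ℝ) < ((d - 1 : ℕ) : ℝ) := by
    have : 0 < d - 1 := by omega
    exact_mod_cast this
  constructor
  · exact Real.log_le_log h1 (by exact_mod_cast Nat.sub_le d 1)
  · rw [← Nat.cast_two, ← Real.log_pow]
    refine Real.log_le_log (by exact_mod_cast (by omega : 0 < d)) ?_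
    obtain ⟨e, rfl⟩ : ∃ e, d = e + 3 := ⟨d - 3, by omega⟩
    have : e + 3 ≤ (e + 3 - 1) ^ 2 := by
      rw [show e + 3 - 1 = e + 2 by omega]
      nlinarith
    exact_mod_cast this

/-- In units of `k log d`, supports and dimensions cost `2 + 2`, and the tail at level 16 gives `3/8
· 16 = 6`. -/
lemma choose_two_mul_tail_le {d k : ℕ} (hd : 3 ≤ d) :
    ((d - 1).choose (2 * k) : ℝ) * (2 ^ (2 * k) * Real.exp (-(3 / 8 * (16 * k * Real.log d)))) ≤
      Real.exp (-(k * Real.log d)) := by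
  have hd' : (0 : ℝ) < d := by exact_mod_cast (by omega : 0 < d)
  have h1 : ((d - 1).choose (2 * k) : ℝ) ≤ Real.exp (2 * k * Real.log d) := by
    have : (d - 1).choose (2 * k) ≤ d ^ (2 * k) :=
      (Nat.choose_le_pow _ _).trans (Nat.pow_le_pow_left (Nat.sub_le d 1) _)
    calc ((d - 1).choose (2 * k) : ℝ) ≤ (d : ℝ) ^ (2 * k) := by exact_mod_cast this
      _ = _ := by
        rw [← Real.exp_log hd', ← Real.exp_nat_mul, Real.log_exp]
        push_cast
        rfl
  have h2 : (2 : ℝ) ^ (2 * k) ≤ Real.exp (2 * k * Real.log d) := by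
    calc (2 : ℝ) ^ (2 * k) ≤ (d : ℝ) ^ (2 * k) := by
          refine pow_le_pow_left₀ (by norm_num) ?_ _
          exact_mod_cast (by omega : 2 ≤ d)
      _ = _ := by
        rw [← Real.exp_log hd', ← Real.exp_nat_mul, Real.log_exp]
        push_cast
        rfl
  calc _ ≤ Real.exp (2 * k * Real.log d) * (Real.exp (2 * k * Real.log d) *
        Real.exp (-(3 / 8 * (16 * k * Real.log d)))) := by gcongr
    _ ≤ _ := by
        rw [← Real.exp_add, ← Real.exp_add]
        apply Real.exp_le_exp.2
        have : 0 ≤ k * Real.log d :=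
          mul_nonneg k.cast_nonneg (Real.log_nonneg (by exact_mod_cast (by omega : 1 ≤ d)))
        linarith

/-- On a well-conditioned design, a regression with a large signal has a large gain. -/
lemma fitGain_le_threshold_tail {SLR : Solver} {K c c' c'' : ℝ} (hK : 2 < K) (hc : 0 < c)
    (h : BlackBoxCondition SLR K c c' c'') {n d k M : ℕ} (hn : 0 < n) (hk : 1 ≤ k)
    (hd : Real.exp 1 * k ≤ d) (hM : 256 * ((K + 2) / 4) ≤ M) (hM1 : 1 ≤ M)
    (hM2 : 2 * (K + 2) / (K - 2) ≤ M) {X : Design n (d - 1)}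
    (hX : WellConditionedOnAtoms ((K + 2) / 4) (k * M + 1) X) {σ : ℝ≥0} (hσ : 0 < σ)
    (hσ2 : (σ : ℝ) ^ 2 ≤ 2) {β : Fin (d - 1) → ℝ} (hβ : hammingNorm β ≤ k)
    (hsig : (64 * c + 109) * (k * Real.log d) < n * sqNorm β / 8) :
    (noiseLaw n σ).real {w | fitGain SLR X (applyDesign X β + w) k ≤ qThreshold n d k} ≤
      c' * Real.exp (-(c'' * k * Real.log (d - 1 : ℕ))) + Real.exp (-(k * Real.log d)) := by
  have hkd := mul_le_mul_of_exp_one_mul_le hd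
  have hd3 : 3 ≤ d := by omega
  have hn' : (0 : ℝ) < n := by exact_mod_cast hn
  have hκ : 0 ≤ (K + 2) / 4 := by linarith
  have hnorm := hX.isNormalized hK hn hk hM2 hM1
  have hγ := hX.quarter_le_restrictedEigenvalue hκ hn hk (by omega) hM hM1
  have hγ0 : 0 < restrictedEigenvalue X k := by linarith
  have hlog0 : 0 ≤ Real.log d := Real.log_nonneg (by exact_mod_cast (by omega : 1 ≤ d))
  set γ := restrictedEigenvalue X k
  let b : (Fin n → ℝ) → Fin (d - 1) → ℝ := fun w => SLR n (d - 1) (applyDesign X β + w) X k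
  let G : Set (Fin n → ℝ) := {w | sqNorm (applyDesign X (b w) - applyDesign X β) / n
    ≤ c / γ ^ 2 * ((σ : ℝ) ^ 2 * k * Real.log (d - 1 : ℕ) / n)}
  have hG : MeasurableSet G := by
    have h1 : Measurable b :=
      (h.measurable n (d - 1) k).comp ((measurable_const.add measurable_id).prodMk measurable_const)
    have h2 : Measurable fun w => applyDesign X (b w) :=
      measurable_applyDesign.comp (measurable_const.prodMk h1)
    exact measurableSet_le ((measurable_sqNorm.comp (h2.sub measurable_const)).div_const _)
      measurable_const
  have hGc : (noiseLaw n σ).real Gᶜ ≤ c' * Real.exp (-(c'' * k * Real.log (d - 1 : ℕ))) := by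
    rw [probReal_compl_eq_one_sub hG]
    have := h.prediction_error n (d - 1) k X (by omega) hnorm hγ0 σ hσ β hβ
    linarith
  -- Two causes of failure: the black box misses its guarantee, or the noise correlates too strongly
  -- with some `2k`-sparse prediction. Off both events the gain exceeds the threshold.
  refine (measureReal_mono (s₂ := Gᶜ ∪ {w | ∃ x : Fin (d - 1) → ℝ, hammingNorm x ≤ 2 * k ∧
    (σ : ℝ) ^ 2 * (16 * k * Real.log d) <
      2 * ∑ a, w a * applyDesign X x a - sqNorm (applyDesign X x)}) ?_ (measure_ne_top _ _)).trans
    ((measureReal_union_le _ _).trans (add_le_add hGc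
      ((noiseLaw_sparse_tail X (by omega) hσ _).trans (choose_two_mul_tail_le hd3))))
  intro w hw
  by_contra hcon
  simp only [Set.mem_union, not_or, Set.mem_compl_iff, not_not, Set.mem_ofPred_eq, not_exists,
    not_and, not_lt] at hcon
  obtain ⟨hwG, hwR⟩ := hcon
  change sqNorm (applyDesign X (b w) - applyDesign X β) / n ≤ _ at hwG
  have hE : sqNorm (applyDesign X (b w) - applyDesign X β) ≤ 32 * c * (k * Real.log d) := by
    have h1 : c / γ ^ 2 ≤ 16 * c := by
      rw [div_le_iff₀ (by positivity)]
      have : 1 / 16 ≤ γ ^ 2 := by nlinarith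
      nlinarith
    have h2 : (σ : ℝ) ^ 2 * k * Real.log (d - 1 : ℕ) ≤ 2 * k * Real.log d := by
      have := (log_sub_one_le hd3).1
      have h0 : 0 ≤ Real.log ((d - 1 : ℕ) : ℝ) :=
        Real.log_nonneg (by exact_mod_cast (by omega : 1 ≤ d - 1))
      gcongr
    rw [← mul_div_assoc, div_le_div_iff_of_pos_right hn'] at hwG
    calc _ ≤ c / γ ^ 2 * ((σ : ℝ) ^ 2 * k * Real.log (d - 1 : ℕ)) := hwG
      _ ≤ 16 * c * (2 * k * Real.log d) := by
        refine mul_le_mul h1 h2 ?_ (by positivity)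
        have h0 : 0 ≤ Real.log ((d - 1 : ℕ) : ℝ) :=
          Real.log_nonneg (by exact_mod_cast (by omega : 1 ≤ d - 1))
        positivity
      _ = _ := by ring
  have hgain := le_sqNorm_sub_sqNorm hβ (h.sparse n (d - 1) k (applyDesign X β + w) X) hwR hE
  have hw' : fitGain SLR X (applyDesign X β + w) k ≤ qThreshold n d k := hw
  rw [fitGain, qThreshold, ← sub_div, div_le_div_iff_of_pos_right hn'] at hw'
  have hsig2 : 1 / 4 * n * sqNorm β ≤ sqNorm (applyDesign X β) := by
    refine hX.quarter_le hκ hk hM hM1 ((sq_sum_abs_le_hammingNorm β).trans ?_)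
    refine mul_le_mul_of_nonneg_right ?_ (sqNorm_nonneg β)
    have : (hammingNorm β : ℝ) ≤ k := by exact_mod_cast hβ
    have : (0 : ℝ) ≤ k := k.cast_nonneg
    linarith
  have hR : (σ : ℝ) ^ 2 * (16 * k * Real.log d) ≤ 2 * (16 * k * Real.log d) := by gcongr
  have hlog : (k : ℝ) * Real.log (d / k) ≤ k * Real.log d :=
    mul_le_mul_of_nonneg_left (log_div_le_log hk (by omega)) k.cast_nonneg
  -- In units of `k log d`: `2E = 64c`, `3R = 96` and the threshold contributes at most 13, hence
  -- `64c + 109`. The signal term is `‖Xβ‖² / 2 ≥ n ‖β‖² / 8`.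
  linarith

lemma typeIIError_le {SLR : Solver} {K c c' c'' : ℝ} (hK : 2 < K) (hc : 0 < c) (hc' : 0 < c')
    (hc'' : 0 < c'') (h : BlackBoxCondition SLR K c c' c'') {n d k M : ℕ} (hk : 1 ≤ k)
    (hd : Real.exp 1 * k ≤ d) (hM : 256 * ((K + 2) / 4) ≤ M) (hM1 : 1 ≤ M)
    (hM2 : 2 * (K + 2) / (K - 2) ≤ M) {cmin θ : ℝ} {u : Fin d → ℝ} (hcmin : 0 < cmin)
    (hθ : 0 < θ) (hθ1 : θ ≤ 1) (hu : sqNorm u = 1) (huk : hammingNorm u ≤ k)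
    (hui : ∃ i, cmin ^ 2 / k ≤ u i ^ 2 ∧ u i ^ 2 ≤ 1 - cmin ^ 2 / k)
    (hsig : θ ^ 2 > 64 * (64 * c + 109) / cmin ^ 2 * ((k : ℝ) ^ 2 * Real.log d / n))
    (hn : (n : ℝ) > (2 * M + 3) / min (chiRate (1 / 2)) (chiRate ((K + 2) / 4)) * k *
      Real.log d) :
    typeIIError SLR n d k θ u ≤
      (3 + c') * Real.exp (-(min (1 / 2) (c'' / 2) * k * Real.log d)) := by
  obtain ⟨i, hi1, hi2⟩ := hui
  have hkd := mul_le_mul_of_exp_one_mul_le hd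
  have hd3 : 3 ≤ d := by omega
  have hk' : (1 : ℝ) ≤ k := by exact_mod_cast hk
  have hd' : (3 : ℝ) ≤ d := by exact_mod_cast hd3
  have hlog0 : 0 ≤ Real.log d := Real.log_nonneg (by linarith)
  set I := min (chiRate (1 / 2)) (chiRate ((K + 2) / 4)) with hI
  have hκ : 1 < (K + 2) / 4 := by linarith
  have hI0 : 0 < I := lt_min (chiRate_pos (by norm_num) (by norm_num))
    (chiRate_pos (by linarith) hκ.ne')
  have hn' : (0 : ℝ) < n := lt_of_le_of_lt (by positivity) hn
  have hn0 : 0 < n := by exact_mod_cast hn'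
  have hIn : (2 * M + 3) * (k * Real.log d) ≤ I * n := by
    have h1 : (2 * M + 3) / I * k * Real.log d = (2 * M + 3) * (k * Real.log d) / I := by ring
    rw [h1, gt_iff_lt, div_lt_iff₀ hI0] at hn
    linarith
  have hβ := le_sqNorm_regCoef hk hθ.le hθ1 hu hi1 hi2
  -- The 64 in the lower bound on `θ²` is the 8 of `le_sqNorm_regCoef` times the 8 here.
  have hsig' : (64 * c + 109) * (k * Real.log d) < n * sqNorm (regCoef θ u i) / 8 := by
    have h1 : n * (θ ^ 2 * cmin ^ 2 / (8 * k)) / 8 ≤ n * sqNorm (regCoef θ u i) / 8 := by gcongr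
    refine lt_of_lt_of_le ?_ h1
    have h2 : (64 * c + 109) * (k * Real.log d) =
        n * ((64 * (64 * c + 109) / cmin ^ 2 * ((k : ℝ) ^ 2 * Real.log d / n)) *
          cmin ^ 2 / (8 * k)) / 8 := by
      field_simp
      ring
    rw [h2]
    gcongr
  have hslice := fun X hX => fitGain_le_threshold_tail (X := X) hK hc h hn0 hk hd hM hM1 hM2
    (not_not.1 hX) (residualSd_pos hθ.le u i) (residualSd_sq_le_two hθ.le hθ1 hu i)
    ((hammingNorm_regCoef_le θ u i).trans huk) hsig'
  have hmain := sampleLaw_real_le_add hθ.le u i (n := n)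
    (A := {q | fitGain SLR q.1 q.2 k ≤ qThreshold n d k})
    (measurableSet_le (measurable_fitGain h _ _ _) measurable_const)
    (not_wellConditionedOnAtoms_le (m := k * M + 1) hθ.le hθ1 hu i hκ) (by positivity) hslice
  have hsub : typeIIError SLR n d k θ u ≤ (sampleLaw n d (spikedCov θ u)).real
      {x | (dropColumn (dataMatrix x) i, column (dataMatrix x) i) ∈
        {q : Design n (d - 1) × (Fin n → ℝ) | fitGain SLR q.1 q.2 k ≤ qThreshold n d k}} := by
    refine measureReal_mono ?_ (measure_ne_top _ _)
    intro x hx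
    exact (qTest_eq_zero_iff _ _ _).1 hx i
  refine (hsub.trans hmain).trans ?_
  set L := (k : ℝ) * Real.log d with hL
  have hL0 : 0 ≤ L := by positivity
  set ρ := min (1 / 2 : ℝ) (c'' / 2) with hρ
  have hρ1 : ρ ≤ 1 / 2 := min_le_left _ _
  have hρ2 : ρ ≤ c'' / 2 := min_le_right _ _
  -- The union bound over atoms costs `(2M + 2) L`. The sample size was chosen to make the rate `(2M
  -- + 3) L`, so `exp (-L)` is left.
  have hpow : (2 * d : ℝ) ^ (k * M + 1) ≤ Real.exp (2 * (M + 1) * L) := by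
    have h1 : (2 * d : ℝ) ≤ Real.exp (2 * Real.log d) := by
      rw [two_mul (Real.log d), Real.exp_add, Real.exp_log (by linarith)]
      nlinarith
    calc (2 * d : ℝ) ^ (k * M + 1) ≤ Real.exp (2 * Real.log d) ^ (k * M + 1) :=
          pow_le_pow_left₀ (by positivity) h1 _
      _ ≤ _ := by
        rw [← Real.exp_nat_mul]
        apply Real.exp_le_exp.2
        push_cast
        have h2 : (k * M + 1 : ℝ) ≤ (M + 1) * k := by linarith
        have h3 := mul_le_mul_of_nonneg_right h2 hlog0
        rw [hL]
        linarith
  have hrate : ∀ r, I ≤ r → Real.exp (-(r * n)) ≤ Real.exp (-((2 * M + 3) * L)) := by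
    intro r hr
    have h2 := mul_le_mul_of_nonneg_right hr hn'.le
    apply Real.exp_le_exp.2
    linarith
  have h1 : (2 * d : ℝ) ^ (k * M + 1) *
      (Real.exp (-(chiRate (1 / 2) * n)) + Real.exp (-(chiRate ((K + 2) / 4) * n))) ≤
      2 * Real.exp (-L) := by
    calc _ ≤ Real.exp (2 * (M + 1) * L) *
          (Real.exp (-((2 * M + 3) * L)) + Real.exp (-((2 * M + 3) * L))) := by
          exact mul_le_mul hpow (add_le_add (hrate _ (min_le_left _ _))
            (hrate _ (min_le_right _ _))) (by positivity) (by positivity)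
      _ = 2 * Real.exp (-L) := by
          rw [← two_mul, mul_left_comm, ← Real.exp_add]
          congr 2
          ring
  have h2 : Real.exp (-L) ≤ Real.exp (-(ρ * L)) := by
    have h3 : ρ * L ≤ 1 * L := mul_le_mul_of_nonneg_right (by linarith) hL0
    apply Real.exp_le_exp.2
    linarith
  -- The black box sees `d - 1` variables; `log d ≤ 2 log (d - 1)` costs half of `c''`.
  have h3 : Real.exp (-(c'' * k * Real.log (d - 1 : ℕ))) ≤ Real.exp (-(ρ * L)) := by
    apply Real.exp_le_exp.2
    have h4 := (log_sub_one_le hd3).2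
    have h5 : c'' / 2 * k * Real.log d ≤ c'' / 2 * k * (2 * Real.log (d - 1 : ℕ)) := by gcongr
    have h6 : ρ * L ≤ c'' / 2 * L := by gcongr
    rw [hL] at h6 ⊢
    linarith
  have h4 : ρ * k * Real.log d = ρ * L := by ring
  rw [h4]
  have h5 := mul_le_mul_of_nonneg_left h3 hc'.le
  linarith

theorem error_probabilities (K c c' c'' : ℝ) (hK : 2 < K) (hc : 0 < c) (hc' : 0 < c')
    (hc'' : 0 < c'') :
      ∃ c₁ c₂ c₃ c₄ : ℝ, 0 < c₁ ∧ 0 < c₂ ∧ 0 < c₃ ∧ 0 < c₄ ∧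
        ∀ SLR : Solver, BlackBoxCondition SLR K c c' c'' →
        ∀ (d n k : ℕ) (cmin θ : ℝ) (u : Fin d → ℝ),
          1 ≤ k → Real.exp 1 * k ≤ d → 0 < cmin → 0 < θ → θ ≤ 1 →
          sqNorm u = 1 → hammingNorm u ≤ k →
          (∃ i, cmin ^ 2 / k ≤ u i ^ 2 ∧ u i ^ 2 ≤ 1 - cmin ^ 2 / k) →
          θ ^ 2 > c₁ / cmin ^ 2 * ((k : ℝ) ^ 2 * Real.log d / n) →
          (n : ℝ) > c₂ * k * Real.log d →
            typeIError SLR n d k ≤ c₃ * Real.exp (-(c₄ * k * Real.log (d / k))) ∧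
            typeIIError SLR n d k θ u ≤ c₃ * Real.exp (-(c₄ * k * Real.log d)) ∧
            ∀ ε : ℝ, 0 < ε → ε ≤ 1 → (k : ℝ) ≤ (d : ℝ) ^ (1 - ε) →
              max (typeIError SLR n d k) (typeIIError SLR n d k θ u) ≤
                c₃ * Real.exp (-(c₄ * ε * k * Real.log d)) := by
  obtain ⟨M, hM⟩ := exists_nat_ge (max (256 * ((K + 2) / 4)) (2 * (K + 2) / (K - 2)))
  have hMa := (le_max_left _ _).trans hM
  have hMb := (le_max_right _ _).trans hM
  have hM1 : 1 ≤ M := by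
    have : (1 : ℝ) ≤ M := by linarith
    exact_mod_cast this
  have hI0 : 0 < min (chiRate (1 / 2)) (chiRate ((K + 2) / 4)) :=
    lt_min (chiRate_pos (by norm_num) (by norm_num))
      (chiRate_pos (by linarith) (by linarith : (1 : ℝ) < (K + 2) / 4).ne')
  have hρ0 : 0 < min (1 / 2 : ℝ) (c'' / 2) := lt_min (by norm_num) (by linarith)
  refine ⟨64 * (64 * c + 109), (2 * M + 3) / min (chiRate (1 / 2)) (chiRate ((K + 2) / 4)),
    3 + c', min (1 / 2) (c'' / 2), by positivity, by positivity, by positivity, hρ0, ?_⟩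
  intro SLR h d n k cmin θ u hk hd hcmin hθ hθ1 hu huk hui hsig hn
  have hk' : (1 : ℝ) ≤ k := by exact_mod_cast hk
  have hd' : (0 : ℝ) < d := lt_of_lt_of_le (by positivity) hd
  have hd1 : 1 ≤ d := by exact_mod_cast hd'
  have hlog0 : 0 ≤ Real.log d := Real.log_nonneg (by exact_mod_cast hd1)
  have hn0 : 0 < n := by
    have : (0 : ℝ) < n := lt_of_le_of_lt (by positivity) hn
    exact_mod_cast this
  have hlog1 := one_le_log_div hk hd
  set ρ := min (1 / 2 : ℝ) (c'' / 2) with hρ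
  have hρ1 : ρ ≤ 1 / 2 := min_le_left _ _
  have hI : typeIError SLR n d k ≤ (3 + c') * Real.exp (-(ρ * k * Real.log (d / k))) := by
    refine (typeIError_le h hn0 hk hd).trans ?_
    refine le_trans ?_ (le_mul_of_one_le_left (Real.exp_nonneg _) (by linarith))
    apply Real.exp_le_exp.2
    have : ρ * (k * Real.log (d / k)) ≤ 1 / 2 * (k * Real.log (d / k)) := by gcongr
    linarith
  have hII := typeIIError_le hK hc hc' hc'' h hk hd hMa hM1 hMb hcmin hθ hθ1 hu huk hui hsig hn
  refine ⟨hI, hII, fun ε hε hε1 hkε => max_le (hI.trans ?_) (hII.trans ?_)⟩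
  · refine mul_le_mul_of_nonneg_left (Real.exp_le_exp.2 (neg_le_neg ?_)) (by positivity)
    -- From `log k ≤ (1 - ε) log d`.
    have h1 : ε * Real.log d ≤ Real.log (d / k) := by
      have h2 := Real.log_le_log (by linarith) hkε
      rw [Real.log_rpow hd'] at h2
      rw [Real.log_div hd'.ne' (by linarith)]
      linarith
    calc ρ * ε * k * Real.log d = ρ * k * (ε * Real.log d) := by ring
      _ ≤ ρ * k * Real.log (d / k) := by gcongr
  · refine mul_le_mul_of_nonneg_left (Real.exp_le_exp.2 (neg_le_neg ?_)) (by positivity)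
    calc ρ * ε * k * Real.log d = ε * (ρ * k * Real.log d) := by ring
      _ ≤ 1 * (ρ * k * Real.log d) := by gcongr
      _ = _ := one_mul _

/-! ### Correctness and running time of the program -/

namespace QProgram

/-! ### Postconditions with step bounds -/

section Runs

variable (SLR : Solver) (T : ℕ → ℕ → ℕ → ℕ)

/-- From the state `s`, the program `P` reaches a state with property `Q` in at most `t` steps. -/
def Runs (P : Prog) (s : MachineState) (Q : MachineState → Prop) (t : ℕ) : Prop :=
  Q (P.exec SLR T s).1 ∧ (P.exec SLR T s).2 ≤ t

variable {SLR T} {P : Prog} {Ps : List Prog} {s s' : MachineState} {Q R : MachineState → Prop}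
  {t t' : ℕ}

lemma Runs.mono (h : Runs SLR T P s Q t) (ht : t ≤ t') (hQ : ∀ s', Q s' → R s') :
    Runs SLR T P s R t' :=
  ⟨hQ _ h.1, h.2.trans ht⟩

lemma Runs.nil (h : Q s) : Runs SLR T (Prog.block []) s Q 1 := ⟨h, le_rfl⟩

lemma Runs.cons (h : Runs SLR T P s R t) (h' : ∀ s', R s' → Runs SLR T (Prog.block Ps) s' Q t') :
    Runs SLR T (Prog.block (P :: Ps)) s Q (t + t') :=
  ⟨(h' _ h.1).1, add_le_add h.2 (h' _ h.1).2⟩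

/-- Keeps the new state as an explicit term, so straight-line code is executed by `rfl`. -/
lemma Runs.step (h : P.exec SLR T s = (s', t)) (h' : Runs SLR T (Prog.block Ps) s' Q t') :
    Runs SLR T (Prog.block (P :: Ps)) s Q (t + t') :=
  Runs.cons (R := fun x => x = s') ⟨by rw [h], by rw [h]⟩ fun _ hx => hx ▸ h'

lemma Runs.loop {x m N : ℕ} (I : ℕ → MachineState → Prop) (hN : s.nat m = N) (h0 : I 0 s)
    (hstep : ∀ i < N, ∀ s', I i s' → Runs SLR T P (s'.setNat x i) (I (i + 1)) t) :
    Runs SLR T (.loop x m P) s (I N) (1 + N * (t + 1)) := by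
  have key : ∀ M ≤ N, I M (runLoop (P.exec SLR T) x s M).1 ∧
      (runLoop (P.exec SLR T) x s M).2 ≤ 1 + M * (t + 1) := by
    intro M
    induction M with
    | zero => exact fun _ => ⟨h0, by simp [runLoop]⟩
    | succ M ih =>
      intro hM
      obtain ⟨h1, h2⟩ := ih (by omega)
      obtain ⟨h3, h4⟩ := hstep M hM _ h1
      refine ⟨h3, ?_⟩
      simp only [runLoop]
      linarith
  subst hN
  exact key _ le_rfl

end Runs

/-- The registers and the data that do not change while the `i`-th column is processed. -/
structure Frame (n d k : ℕ) (thr : ℝ) (D : ℕ → ℕ → ℝ) (i o : ℕ) (s : MachineState) : Prop where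
  rows : s.nat 0 = n
  cols : s.nat 1 = d
  sparsity : s.nat 2 = k
  output : s.nat 3 = o
  zero : s.nat 4 = 0
  one : s.nat 5 = 1
  others : s.nat 6 = d - 1
  index : s.nat 7 = i
  threshold : s.real 0 = thr
  samples : s.real 1 = n
  data : s.mem 0 = D

/-! ### Correctness and cost of the program blocks -/

section Frame

variable {n d k : ℕ} {thr : ℝ} {D : ℕ → ℕ → ℝ} {i o : ℕ} {s : MachineState}

lemma Frame.setNat (h : Frame n d k thr D i o s) {x : ℕ} (hx : 8 ≤ x) (v : ℕ) :
    Frame n d k thr D i o (s.setNat x v) := by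
  obtain ⟨h0, h1, h2, h3, h4, h5, h6, h7, h8, h9, h10⟩ := h
  have hne : ∀ y, y < 8 → (s.setNat x v).nat y = s.nat y := fun y hy => if_neg (by omega)
  exact ⟨by rwa [hne _ (by norm_num)], by rwa [hne _ (by norm_num)], by rwa [hne _ (by norm_num)],
    by rwa [hne _ (by norm_num)], by rwa [hne _ (by norm_num)], by rwa [hne _ (by norm_num)],
    by rwa [hne _ (by norm_num)], by rwa [hne _ (by norm_num)], h8, h9, h10⟩

lemma Frame.setIndex (h : Frame n d k thr D i o s) (v : ℕ) :
    Frame n d k thr D v o (s.setNat 7 v) :=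
  ⟨h.rows, h.cols, h.sparsity, h.output, h.zero, h.one, h.others, rfl, h.threshold, h.samples,
    h.data⟩

lemma Frame.setOutput (h : Frame n d k thr D i o s) (v : ℕ) :
    Frame n d k thr D i v (s.setNat 3 v) :=
  ⟨h.rows, h.cols, h.sparsity, rfl, h.zero, h.one, h.others, h.index, h.threshold, h.samples,
    h.data⟩

lemma Frame.setReal (h : Frame n d k thr D i o s) {r : ℕ} (hr : 2 ≤ r) (v : ℝ) :
    Frame n d k thr D i o (s.setReal r v) := by
  have hne : ∀ q, q < 2 → (s.setReal r v).real q = s.real q := fun q hq => if_neg (by omega)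
  exact ⟨h.rows, h.cols, h.sparsity, h.output, h.zero, h.one, h.others, h.index,
    (hne 0 (by norm_num)).trans h.threshold, (hne 1 (by norm_num)).trans h.samples, h.data⟩

lemma Frame.setMem (h : Frame n d k thr D i o s) {A : ℕ} (hA : A ≠ 0) (x y : ℕ) (v : ℝ) :
    Frame n d k thr D i o (s.setMem A x y v) := by
  refine ⟨h.rows, h.cols, h.sparsity, h.output, h.zero, h.one, h.others, h.index,
    h.threshold, h.samples, ?_⟩
  rw [← h.data]
  funext x' y'
  exact if_neg fun h' => hA h'.1.symm

lemma Frame.setVec (h : Frame n d k thr D i o s) {A : ℕ} (hA : A ≠ 0) {p : ℕ} (v : Fin p → ℝ) :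
    Frame n d k thr D i o (s.setVec A v) := by
  refine ⟨h.rows, h.cols, h.sparsity, h.output, h.zero, h.one, h.others, h.index,
    h.threshold, h.samples, ?_⟩
  rw [← h.data]
  funext x' y'
  exact dif_neg fun h' => hA h'.1.symm

variable (SLR : Solver) (T : ℕ → ℕ → ℕ → ℕ)

/-- The index of the `j`-th column other than `i`. -/
def skipNat (i j : ℕ) : ℕ := if j < i then j else j + 1

lemma runs_writeInstance (h : Frame n d k thr D i o s) :
    Runs SLR T writeInstance s (fun s' => Frame n d k thr D i o s' ∧
      (∀ a < n, s'.mem 1 a 0 = D a i) ∧ ∀ a < n, ∀ j < d - 1, s'.mem 2 a j = D a (skipNat i j))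
      (1 + n * (5 + 6 * (d - 1))) := by
  refine (Runs.loop (t := 4 + 6 * (d - 1)) (fun a s' => Frame n d k thr D i o s' ∧
    (∀ a' < a, s'.mem 1 a' 0 = D a' i) ∧
      ∀ a' < a, ∀ j < d - 1, s'.mem 2 a' j = D a' (skipNat i j)) h.rows
      ⟨h, by simp, by simp⟩ ?_).mono (le_of_eq (by ring)) fun _ h' => h'
  rintro a - s₀ ⟨hF, hy, hZ⟩
  refine Runs.mono (t := 1 + (1 + ((1 + (d - 1) * (5 + 1)) + 1)))
    -- Inner invariant: the response is written through row `a`, the design has all rows before `a`,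
    -- and row `a` is filled up to column `j`.
    (Runs.step rfl (Runs.step rfl (Runs.cons (Runs.loop (t := 5) (fun j s' =>
      Frame n d k thr D i o s' ∧ s'.nat 8 = a ∧ (∀ a' < a + 1, s'.mem 1 a' 0 = D a' i) ∧
        (∀ a' < a, ∀ j < d - 1, s'.mem 2 a' j = D a' (skipNat i j)) ∧
        ∀ j' < j, s'.mem 2 a j' = D a (skipNat i j')) hF.others ⟨?_, rfl, ?_, ?_, by simp⟩ ?_)
      fun s' hs' => Runs.nil hs'))) (le_of_eq (by ring)) ?_
  · exact ((hF.setNat le_rfl _).setReal (by norm_num) _).setMem (by norm_num) _ _ _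
  · intro a' ha'
    rcases Nat.lt_succ_iff_lt_or_eq.1 ha' with h1 | rfl
    · simp [MachineState.setMem, MachineState.setReal, MachineState.setNat, h1.ne, hy a' h1]
    · simp [MachineState.setMem, MachineState.setReal, MachineState.setNat, hF.data, hF.index,
        hF.zero]
  · intro a' ha' j hj
    simp [MachineState.setMem, MachineState.setReal, MachineState.setNat, hZ a' ha' j hj]
  · rintro j hj s₁ ⟨hF₁, h8, hy₁, hZ₁, hr₁⟩
    have hif : Runs SLR T (.natIfLt 9 7 (.natAdd 10 9 4) (.natAdd 10 9 5)) (s₁.setNat 9 j)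
        (fun s' => s' = (s₁.setNat 9 j).setNat 10 (skipNat i j)) 2 := by
      have e7 : (s₁.setNat 9 j).nat 7 = i := hF₁.index
      have e9 : (s₁.setNat 9 j).nat 9 = j := rfl
      have e4 : (s₁.setNat 9 j).nat 4 = 0 := hF₁.zero
      have e5 : (s₁.setNat 9 j).nat 5 = 1 := hF₁.one
      unfold Runs
      simp only [Prog.exec, e7, e9, e4, e5, skipNat]
      split_ifs <;> simp
    refine Runs.mono (t := 2 + (1 + (1 + 1))) (Runs.cons hif ?_) le_rfl fun _ h' => h'
    rintro _ rfl
    refine Runs.step rfl (Runs.step rfl (Runs.nil ⟨?_, h8, ?_, ?_, ?_⟩))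
    · exact (((hF₁.setNat (by norm_num) _).setNat (by norm_num) _).setReal (by norm_num) _).setMem
        (by norm_num) _ _ _
    · intro a' ha'
      simp [MachineState.setMem, MachineState.setReal, MachineState.setNat, hy₁ a' ha']
    · intro a' ha' j' hj'
      simp [MachineState.setMem, MachineState.setReal, MachineState.setNat, hZ₁ a' ha' j' hj', h8,
        ha'.ne]
    · intro j' hj'
      rcases Nat.lt_succ_iff_lt_or_eq.1 hj' with h1 | rfl
      · simp [MachineState.setMem, MachineState.setReal, MachineState.setNat, h1.ne, hr₁ j' h1]
      · simp [MachineState.setMem, MachineState.setReal, MachineState.setNat, hF₁.data, h8]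
  · rintro s' ⟨h1, -, h3, h4, h5⟩
    refine ⟨h1, h3, fun a' ha' j hj => ?_⟩
    rcases Nat.lt_succ_iff_lt_or_eq.1 ha' with h6 | rfl
    · exact h4 a' h6 j hj
    · exact h5 j hj

lemma runs_sums (h : Frame n d k thr D i o s) :
    Runs SLR T sums s (fun s' => Frame n d k thr D i o s' ∧
      s'.real 2 = ∑ a ∈ Finset.range n, s.mem 1 a 0 ^ 2 ∧
      s'.real 3 = ∑ a ∈ Finset.range n,
        (s.mem 1 a 0 - ∑ j ∈ Finset.range (d - 1), s.mem 2 a j * s.mem 3 j 0) ^ 2)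
      (4 + n * (8 + 6 * (d - 1))) := by
  refine Runs.mono (t := 1 + (1 + (1 + n * ((7 + 6 * (d - 1)) + 1) + 1)))
    (Runs.step rfl (Runs.step rfl (Runs.cons (Runs.loop (t := 7 + 6 * (d - 1)) (fun a s' =>
      Frame n d k thr D i o s' ∧ s'.mem = s.mem ∧
      s'.real 2 = ∑ a ∈ Finset.range a, s.mem 1 a 0 ^ 2 ∧
      s'.real 3 = ∑ a ∈ Finset.range a,
        (s.mem 1 a 0 - ∑ j ∈ Finset.range (d - 1), s.mem 2 a j * s.mem 3 j 0) ^ 2)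
      h.rows ⟨?_, rfl, ?_, ?_⟩ ?_) fun s' hs' => Runs.nil hs'))) (le_of_eq (by ring)) ?_
  · exact (h.setReal (by norm_num) _).setReal (by norm_num) _
  · simp [MachineState.setReal]
  · simp [MachineState.setReal]
  · rintro a - s₀ ⟨hF, hm, h2, h3⟩
    refine Runs.mono (t := 1 + (1 + (1 + ((1 + (d - 1) * (5 + 1)) + (1 + (1 + 1))))))
      (Runs.step rfl (Runs.step rfl (Runs.step rfl (Runs.cons (Runs.loop (t := 5) (fun j s' =>
        Frame n d k thr D i o s' ∧ s'.mem = s.mem ∧ s'.nat 8 = a ∧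
        s'.real 2 = ∑ a ∈ Finset.range (a + 1), s.mem 1 a 0 ^ 2 ∧
        s'.real 3 = ∑ a ∈ Finset.range a,
          (s.mem 1 a 0 - ∑ j ∈ Finset.range (d - 1), s.mem 2 a j * s.mem 3 j 0) ^ 2 ∧
        s'.real 4 = s.mem 1 a 0 - ∑ j ∈ Finset.range j, s.mem 2 a j * s.mem 3 j 0)
        hF.others ⟨?_, hm, rfl, ?_, ?_, ?_⟩ ?_) ?_)))) (le_of_eq (by ring)) fun _ h' => h'
    · exact (((hF.setNat le_rfl _).setReal (by norm_num) _).setReal (by norm_num) _).setReal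
        (by norm_num) _
    · simp [MachineState.setReal, MachineState.setNat, hm, h2, hF.zero, Finset.sum_range_succ, sq]
    · simp [MachineState.setReal, MachineState.setNat, h3]
    · simp [MachineState.setReal, MachineState.setNat, hm, hF.zero]
    · rintro j hj s₁ ⟨hF₁, hm₁, h8, h2₁, h3₁, h4₁⟩
      refine Runs.mono (t := 1 + (1 + (1 + (1 + 1)))) (Runs.step rfl (Runs.step rfl (Runs.step rfl
        (Runs.step rfl (Runs.nil ⟨?_, hm₁, h8, h2₁, h3₁, ?_⟩))))) le_rfl fun _ h' => h'
      · exact ((((hF₁.setNat (by norm_num) _).setReal (by norm_num) _).setReal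
          (by norm_num) _).setReal (by norm_num) _).setReal (by norm_num) _
      · simp [MachineState.setReal, MachineState.setNat, hm₁, h8, h4₁, hF₁.zero,
          Finset.sum_range_succ]
        ring
    · rintro s₁ ⟨hF₁, hm₁, -, h2₁, h3₁, h4₁⟩
      refine Runs.step rfl (Runs.step rfl (Runs.nil ⟨?_, hm₁, h2₁, ?_⟩))
      · exact (hF₁.setReal (by norm_num) _).setReal (by norm_num) _
      · simp [MachineState.setReal, h3₁, h4₁, Finset.sum_range_succ, sq]
  · rintro s' ⟨h1, -, h2, h3⟩
    exact ⟨h1, h2, h3⟩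

/-- The types of the arguments of the black box depend on register contents; substituting these
equalities away avoids casts. -/
lemma exec_call_eq {p : ℕ} (hn : s.nat 0 = n) (hp : s.nat 6 = p) (hk : s.nat 2 = k)
    {y : Fin n → ℝ} {Z : Design n p} (hy : ∀ a : Fin n, s.mem 1 a 0 = y a)
    (hZ : ∀ (a : Fin n) (j : Fin p), s.mem 2 a j = Z a j) :
    (Prog.call 1 2 3 0 6 2).exec SLR T s = (s.setVec 3 (SLR n p y Z k), T p n k + 1) := by
  subst hn hp hk
  obtain rfl : (fun a : Fin _ => s.mem 1 a 0) = y := funext hy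
  obtain rfl : (fun (a : Fin _) (j : Fin _) => s.mem 2 a j) = Z :=
    funext fun a => funext fun j => hZ a j
  rfl

open Classical in
lemma runs_body (X : Design n d) (hD : ∀ (a : Fin n) (j : Fin d), D a j = X a j) (l : Fin d)
    (h : Frame n d k thr D l o s) :
    Runs SLR T (Prog.block [writeInstance, .call 1 2 3 0 6 2, sums, .realDiv 2 2 1,
      .realDiv 3 3 1, .realSub 5 2 3, .realIfLt 0 5 (.natConst 3 1) .skip]) s
      (fun s' => Frame n d k thr D l (if thr < qStat SLR X k l then 1 else o) s')
      (T (d - 1) n k + 12 + n * (13 + 12 * (d - 1))) := by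
  have hsk : ∀ j : Fin (d - 1), skipNat l j = (skipIndex l j : Fin d) := fun j => rfl
  refine Runs.mono (t := (1 + n * (5 + 6 * (d - 1))) + ((T (d - 1) n k + 1) +
    ((4 + n * (8 + 6 * (d - 1))) + (1 + (1 + (1 + (2 + 1)))))))
    (Runs.cons (runs_writeInstance SLR T h) ?_) (le_of_eq (by ring)) fun _ h' => h'
  rintro s₁ ⟨hF₁, hy, hZ⟩
  have hy' : ∀ a : Fin n, s₁.mem 1 a 0 = column X l a := fun a => by
    rw [hy a a.2, hD]
    rfl
  have hZ' : ∀ (a : Fin n) (j : Fin (d - 1)), s₁.mem 2 a j = dropColumn X l a j := fun a j => by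
    rw [hZ a a.2 j j.2, hsk, hD]
    rfl
  refine Runs.step (exec_call_eq SLR T hF₁.rows hF₁.others hF₁.sparsity hy' hZ') ?_
  set b := SLR n (d - 1) (column X l) (dropColumn X l) k with hb
  refine Runs.cons (runs_sums SLR T (hF₁.setVec (by norm_num) b)) ?_
  rintro s₂ ⟨hF₂, h2, h3⟩
  have h2' : s₂.real 2 = sqNorm (column X l) := by
    rw [h2, Finset.sum_range, sqNorm]
    refine Finset.sum_congr rfl fun a _ => ?_
    rw [← hy' a]
    simp [MachineState.setVec]
  have h3' : s₂.real 3 = sqNorm (column X l - applyDesign (dropColumn X l) b) := by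
    rw [h3, Finset.sum_range, sqNorm]
    refine Finset.sum_congr rfl fun a _ => ?_
    rw [Pi.sub_apply, ← hy' a, applyDesign, Finset.sum_range]
    simp [MachineState.setVec, hZ']
  refine Runs.step rfl (Runs.step rfl (Runs.step rfl ?_))
  set s₃ := ((s₂.setReal 2 (s₂.real 2 / s₂.real 1)).setReal 3
    ((s₂.setReal 2 (s₂.real 2 / s₂.real 1)).real 3 / (s₂.setReal 2 (s₂.real 2 / s₂.real 1)).real 1))
    with hs₃
  have hF₄ : Frame n d k thr D l o (s₃.setReal 5 (s₃.real 2 - s₃.real 3)) :=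
    ((hF₂.setReal (by norm_num) _).setReal (by norm_num) _).setReal (by norm_num) _
  have h5 : (s₃.setReal 5 (s₃.real 2 - s₃.real 3)).real 5 = qStat SLR X k l := by
    simp [hs₃, MachineState.setReal, hF₂.samples, h2', h3', qStat, hb]
  refine Runs.cons (t := 2) (R := fun s' => Frame n d k thr D l
    (if thr < qStat SLR X k l then 1 else o) s') ?_ fun s' hs' => Runs.nil hs'
  unfold Runs
  simp only [Prog.exec, h5, hF₄.threshold]
  split_ifs
  · exact ⟨hF₄.setOutput 1, le_rfl⟩
  · exact ⟨hF₄, le_rfl⟩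

lemma runs_setup (X : Design n d) :
    Runs SLR T setup (inputState X k)
      (Frame n d k (qThreshold n d k) ((inputState X k).mem 0) 0 0) 14 := by
  refine Runs.mono (t := 1 + (1 + (1 + (1 + (1 + (1 + (1 + (1 + (1 + (1 + (1 + (1 + (1 + 1)))))))))))))
    (Runs.step rfl <| Runs.step rfl <| Runs.step rfl <| Runs.step rfl <| Runs.step rfl <|
      Runs.step rfl <| Runs.step rfl <| Runs.step rfl <| Runs.step rfl <| Runs.step rfl <|
      Runs.step rfl <| Runs.step rfl <| Runs.step rfl <| Runs.nil
        ⟨rfl, rfl, rfl, rfl, rfl, rfl, rfl, rfl, ?_, ?_, rfl⟩) le_rfl fun _ h' => h'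
  · simp [MachineState.setReal, MachineState.setNat, inputState, qThreshold]
  · simp [MachineState.setReal, MachineState.setNat, inputState]

open Classical in
lemma runs_main (X : Design n d) :
    Runs SLR T main (inputState X k) (fun s' => s'.nat 3 = qTest SLR X k)
      (14 + (1 + d * (T (d - 1) n k + 12 + n * (13 + 12 * (d - 1)) + 1))) := by
  have hsetup := runs_setup (k := k) SLR T X
  have hD : ∀ (a : Fin n) (j : Fin d), (inputState X k).mem 0 a j = X a j := fun a j => by
    simp [inputState]
  have hloop := Runs.loop (SLR := SLR) (T := T) (x := 7)
    -- At the start of a round the index register still holds an old value, hence the existential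
    -- `i₀`. The output register records whether an index below `l` has exceeded the threshold.
    (fun l s' => ∃ i₀, Frame n d k (qThreshold n d k) ((inputState X k).mem 0) i₀
      (if ∃ i : Fin d, (i : ℕ) < l ∧ qThreshold n d k < qStat SLR X k i then 1 else 0) s')
    hsetup.1.cols ⟨0, by simpa using hsetup.1⟩ (fun l hl s' ⟨i₀, h⟩ =>
      (runs_body SLR T X hD ⟨l, hl⟩ (h.setIndex l)).mono le_rfl fun s'' h'' => ⟨l, ?_⟩)
  · refine ⟨?_, add_le_add hsetup.2 hloop.2⟩
    obtain ⟨i₀, h⟩ := hloop.1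
    refine h.output.trans ?_
    simp only [qTest, Fin.is_lt, true_and]
  · convert h'' using 1
    have hiff : (∃ i : Fin d, (i : ℕ) < l + 1 ∧ qThreshold n d k < qStat SLR X k i) ↔
        qThreshold n d k < qStat SLR X k ⟨l, hl⟩ ∨
          ∃ i : Fin d, (i : ℕ) < l ∧ qThreshold n d k < qStat SLR X k i := by
      constructor
      · rintro ⟨i, hi, hq⟩
        rcases Nat.lt_succ_iff_lt_or_eq.1 hi with h1 | rfl
        · exact Or.inr ⟨i, h1, hq⟩
        · exact Or.inl hq
      · rintro (hq | ⟨i, hi, hq⟩)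
        · exact ⟨⟨l, hl⟩, l.lt_succ_self, hq⟩
        · exact ⟨i, hi.trans l.lt_succ_self, hq⟩
    by_cases h1 : qThreshold n d k < qStat SLR X k ⟨l, hl⟩ <;>
      simp only [hiff, h1, true_or, false_or, if_true, if_false]

end Frame

theorem main_correct_and_fast : ∃ C : ℕ, ∀ (SLR : Solver) (T : ℕ → ℕ → ℕ → ℕ) (d n k : ℕ)
    (X : Design n d), 1 ≤ d → 1 ≤ n →
      (main.exec SLR T (inputState X k)).1.nat 3 = qTest SLR X k ∧
      (main.exec SLR T (inputState X k)).2 ≤ C * (d * T (d - 1) n k + d ^ 2 * n) := by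
  refine ⟨42, fun SLR T d n k X hd hn => ?_⟩
  obtain ⟨h1, h2⟩ := runs_main (k := k) SLR T X
  refine ⟨h1, h2.trans ?_⟩
  -- Since `d, n ≥ 1`, the set-up cost and the lower-order terms are absorbed into `d² n`; the
  -- substitution makes this a comparison of polynomials with natural coefficients.
  obtain ⟨e, rfl⟩ : ∃ e, d = e + 1 := ⟨d - 1, by omega⟩
  obtain ⟨m, rfl⟩ : ∃ m, n = m + 1 := ⟨n - 1, by omega⟩
  rw [Nat.add_sub_cancel]
  generalize T e (m + 1) k = t
  ring_nf
  nlinarith [Nat.zero_le (e * t), Nat.zero_le (e * m), Nat.zero_le (e ^ 2 * m),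
    Nat.zero_le (e ^ 2), Nat.zero_le t, Nat.zero_le m, Nat.zero_le e]

end QProgram

theorem theorem1 :
    -- error probabilities
    (∀ K c c' c'' : ℝ, 2 < K → 0 < c → 0 < c' → 0 < c'' →
      ∃ c₁ c₂ c₃ c₄ : ℝ, 0 < c₁ ∧ 0 < c₂ ∧ 0 < c₃ ∧ 0 < c₄ ∧
        ∀ SLR : Solver, BlackBoxCondition SLR K c c' c'' →
        ∀ (d n k : ℕ) (cmin θ : ℝ) (u : Fin d → ℝ),
          1 ≤ k → Real.exp 1 * k ≤ d → 0 < cmin → 0 < θ → θ ≤ 1 →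
          sqNorm u = 1 → hammingNorm u ≤ k →
          (∃ i, cmin ^ 2 / k ≤ u i ^ 2 ∧ u i ^ 2 ≤ 1 - cmin ^ 2 / k) →
          θ ^ 2 > c₁ / cmin ^ 2 * ((k : ℝ) ^ 2 * Real.log d / n) →
          (n : ℝ) > c₂ * k * Real.log d →
            typeIError SLR n d k ≤ c₃ * Real.exp (-(c₄ * k * Real.log (d / k))) ∧
            typeIIError SLR n d k θ u ≤ c₃ * Real.exp (-(c₄ * k * Real.log d)) ∧
            ∀ ε : ℝ, 0 < ε → ε ≤ 1 → (k : ℝ) ≤ (d : ℝ) ^ (1 - ε) →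
              max (typeIError SLR n d k) (typeIIError SLR n d k θ u) ≤
                c₃ * Real.exp (-(c₄ * ε * k * Real.log d))) ∧
    -- running time
    (∃ C : ℕ, ∀ (SLR : Solver) (T : ℕ → ℕ → ℕ → ℕ) (d n k : ℕ) (X : Design n d),
      1 ≤ d → 1 ≤ n →
        (QProgram.main.exec SLR T (inputState X k)).1.nat 3 = qTest SLR X k ∧
        (QProgram.main.exec SLR T (inputState X k)).2 ≤ C * (d * T (d - 1) n k + d ^ 2 * n)) :=
  ⟨error_probabilities, QProgram.main_correct_and_fast⟩
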